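/- A \emph{meet-tree} is a structure $(A,\le,\wedge)$ where $(A,\le)$ is a partial order in which every set $\{a\in A: a\le c\}$ is linearly ordered, every two elements have a common lower bound, and $a\wedge b$ is the largest common lower bound of $a$ and $b$. Let $\mathbf T$ be the countable generic meet-tree, i.e. the Fraïssé limit of the class of all finite meet-trees (the countable ultrahomogeneous structure in the language $\{\le,\wedge\}$ whose age is the class of finite meet-trees). A \emph{partial automorphism} of a structure $M$ is a partial function $p\colon M\to M$ preserving quantifier-free types over $\emptyset$; it is \emph{finite} if $\operatorname{dom}(p)$ is finite. A point $a\in\operatorname{dom}(p)$ is an \emph{initial point} of $p$ if $a\notin\operatorname{range}(p)$ or $p^k(a)=a$ for some $k>0$. A finite partial automorphism $p$ of $\mathbf T$ is \emph{pseudo existentially closed} (PEC) if for every partial automorphism $q\supseteq p$ of $\mathbf T$, all initial points $\eta_0,\mu_0,\zeta_0$ of $p$, and all integers $m_1,m_2>0$ such that $q^{m_1}(\mu_0)$ and $q^{m_2}(\zeta_0)$ are defined, there are integers $m_1',m_2',m_1'',m_2''>0$ such that: \begin{itemize} \item if $p^{m_1}(\mu_0)$ is undefined, then $m_1'\neq m_1''$;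 \item $p^{m_1'}(\mu_0)$, $p^{m_2'}(\zeta_0)$, $p^{m_1''}(\mu_0)$, $p^{m_2''}(\zeta_0)$ are defined, and the triples $(\eta_0,q^{m_1}(\mu_0),q^{m_2}(\zeta_0))$, $(\eta_0,p^{m_1'}(\mu_0),p^{m_2'}(\zeta_0))$, $(\eta_0,p^{m_1''}(\mu_0),p^{m_2''}(\zeta_0))$ have the same quantifier-free type in $\mathbf T$; \item if there is a natural number $k$ such that $q^{2k}(\mu_0)$ is defined and $\mu_0\wedge q^k(\mu_0)\neq q^k(\mu_0)\wedge q^{2k}(\mu_0)$, then for the least such $k$ we have $m_1\equiv m_1'\equiv m_1''\pmod k$. \end{itemize} A \emph{strict extension} of $p$ is a partial automorphism $f\supseteq p$ which is an automorphism of a substructure, namely of $\operatorname{dom}(f)=\operatorname{range}(f)$, such that this substructure is generated by the $f$-orbits of the elements of $\operatorname{dom}(p)$. Two strict extensions $f_1,f_2$ of $p$ are \emph{isomorphic over $p$} if there is an isomorphism $\theta\colon\operatorname{dom}(f_1)\to\operatorname{dom}(f_2)$ fixing $\operatorname{dom}(p)$ pointwise with $\theta\circ f_1=f_2\circ\theta$.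 Finally, $p$ is \emph{determined} if it has a strict extension and any two strict extensions of $p$ are isomorphic over $p$. \textbf{Corollary.} Every pseudo existentially closed finite partial automorphism of $\mathbf T$ is determined. -/

import Mathlib

open FirstOrder FirstOrder.Language CategoryTheory

/-! ### Partial automorphisms of first order structures and their strict extensions -/

namespace PartialAut

universe u v w

/-- The tuples `x` and `y` have the same quantifier-free type (over the empty set) in `M`. -/
def SameQFType (L : FirstOrder.Language.{u, v}) {M : Type w} [L.Structure M] {n : ℕ}
    (x y : Fin n → M) : Prop :=
  ∀ φ : L.Formula (Fin n), BoundedFormula.IsQF φ → (φ.Realize x ↔ φ.Realize y)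

/-- A partial function `p : M →. M` is a partial automorphism if it preserves quantifier-free
types over the empty set. Its domain is an arbitrary set, not necessarily a substructure. -/
def IsPartialAut (L : FirstOrder.Language.{u, v}) {M : Type w} [L.Structure M] (p : M →. M) : Prop :=
  ∀ (n : ℕ) (x y : Fin n → M), (∀ i, y i ∈ p (x i)) → SameQFType L x y

/-- The partial function `q` extends the partial function `p`. -/
def Extends {M : Type w} (p q : M →. M) : Prop :=
  ∀ a b : M, b ∈ p a → b ∈ q a

/-- The powers `p ^ n` (for natural `n`) of a partial function;
`(pow p n a).Dom` says that `p ^ n (a)` is defined. -/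
def pow {M : Type w} (p : M →. M) : ℕ → M →. M
  | 0 => PFun.id M
  | n + 1 => p.comp (pow p n)

/-- A point of the domain of `p` which is not in the range of `p` or lies in a cyclic orbit. -/
def IsInitialPoint {M : Type w} (p : M →. M) (a : M) : Prop :=
  a ∈ p.Dom ∧ (a ∉ p.ran ∨ ∃ k : ℕ, 0 < k ∧ a ∈ pow p k a)

/-- A strict extension of `p`: an automorphism of a substructure of `M` which extends `p` and
such that the substructure is generated by the (two-sided) orbits of elements of `p.Dom`. -/
structure StrictExtension (L : FirstOrder.Language.{u, v}) {M : Type w} [L.Structure M] (p : M →. M) where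
  /-- the substructure on which the automorphism is defined -/
  carrier : L.Substructure M
  /-- the automorphism -/
  aut : carrier ≃[L] carrier
  extends_p : ∀ a b : M, b ∈ p a → ∃ h : a ∈ carrier, (aut ⟨a, h⟩ : M) = b
  generated : Substructure.closure L
    {b : M | ∃ a : carrier, (a : M) ∈ p.Dom ∧
      ∃ n : ℤ, b = ((aut.toEquiv : Equiv.Perm carrier) ^ n) a} = carrier

/-- Two strict extensions of `p` are isomorphic over `p` if some isomorphism between their
domains fixes `p.Dom` pointwise and conjugates one automorphism to the other. -/
def StrictExtension.IsoOver {L : FirstOrder.Language.{u, v}} {M : Type w} [L.Structure M] {p : M →. M}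
    (f g : StrictExtension L p) : Prop :=
  ∃ θ : f.carrier ≃[L] g.carrier,
    (∀ a : f.carrier, (a : M) ∈ p.Dom → (θ a : M) = a) ∧
    ∀ a : f.carrier, θ (f.aut a) = g.aut (θ a)

/-- `p` is determined: it admits a strict extension, unique up to isomorphism over `p`. -/
def IsDetermined (L : FirstOrder.Language.{u, v}) {M : Type w} [L.Structure M] (p : M →. M) : Prop :=
  ∃ f : StrictExtension L p, ∀ g : StrictExtension L p, f.IsoOver g

end PartialAut

/-! ### Meet-trees -/

namespace MeetTree

universe w

/-- Function symbols of the language of meet-trees: a binary meet. -/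
inductive FunctionSymbol : ℕ → Type
  | meet : FunctionSymbol 2

/-- Relation symbols of the language of meet-trees: a binary order relation. -/
inductive RelationSymbol : ℕ → Type
  | le : RelationSymbol 2

/-- The language `{≤, ∧}` of meet-trees. -/
def lang : FirstOrder.Language.{0, 0} := ⟨FunctionSymbol, RelationSymbol⟩

instance countable_functions : Countable (Σ l, lang.Functions l) := by
  have h : ∀ l, Countable (lang.Functions l) := by
    intro l
    have : Subsingleton (lang.Functions l) := by
      constructor
      intro a b
      change FunctionSymbol l at a b
      cases a
      cases b
      rfl
    infer_instance
  infer_instance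

/-- The interpretation of `≤`. -/
def le {A : Type w} [lang.Structure A] (a b : A) : Prop :=
  Structure.RelMap (L := lang) (M := A) RelationSymbol.le ![a, b]

/-- The interpretation of `∧`. -/
def meet {A : Type w} [lang.Structure A] (a b : A) : A :=
  Structure.funMap (L := lang) (M := A) FunctionSymbol.meet ![a, b]

/-- The structure `A` is a meet-tree: a partial order in which every set `{a | a ≤ c}` is linearly
ordered, every pair has a common lower bound, and `meet a b` is the largest
common lower bound of `a` and `b`. -/
structure IsMeetTree (A : Type w) [lang.Structure A] : Prop where
  refl : ∀ a : A, le a a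
  antisymm : ∀ a b : A, le a b → le b a → a = b
  trans : ∀ a b c : A, le a b → le b c → le a c
  semilinear : ∀ a b c : A, le a c → le b c → le a b ∨ le b a
  common_lower_bound : ∀ a b : A, ∃ c : A, le c a ∧ le c b
  meet_le_left : ∀ a b : A, le (meet a b) a
  meet_le_right : ∀ a b : A, le (meet a b) b
  le_meet : ∀ a b c : A, le c a → le c b → le c (meet a b)

/-- The class of all finite meet-trees. -/
def finiteMeetTrees : Set (Bundled.{w} lang.Structure) :=
  {A | Finite A ∧ IsMeetTree A}

/-- `T` is the countable generic meet-tree: the Fraïssé limit of the class of finite meet-trees. -/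
def IsGenericMeetTree (T : Type w) [lang.Structure T] [Countable T] : Prop :=
  IsFraisseLimit (L := lang) finiteMeetTrees.{w} T

open PartialAut

/-- The values `q ^ k (a)` and `q ^ (2 k) (a)` are defined, and
`a ∧ q ^ k (a) ≠ q ^ k (a) ∧ q ^ (2 k) (a)`. -/
def MeetsDiffer {T : Type w} [lang.Structure T] (q : T →. T) (a : T) (k : ℕ) : Prop :=
  ∃ x ∈ pow q k a, ∃ y ∈ pow q (2 * k) a, meet a x ≠ meet x y

/-- The partial automorphism `p` is pseudo existentially closed (PEC). Here `η₀, μ₀, ζ₀` are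
initial points of `p`, while `b = q ^ m₁ (μ₀)` and `c = q ^ m₂ (ζ₀)`; the witnesses are
`b' = p ^ m₁' (μ₀)`, `c' = p ^ m₂' (ζ₀)`, `b'' = p ^ m₁'' (μ₀)`, `c'' = p ^ m₂'' (ζ₀)`. -/
def IsPEC {T : Type w} [lang.Structure T] (p : T →. T) : Prop :=
  ∀ q : T →. T, IsPartialAut lang q → Extends p q →
  ∀ η₀ μ₀ ζ₀ : T, IsInitialPoint p η₀ → IsInitialPoint p μ₀ → IsInitialPoint p ζ₀ →
  ∀ m₁ m₂ : ℕ, 0 < m₁ → 0 < m₂ →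
  ∀ b c : T, b ∈ pow q m₁ μ₀ → c ∈ pow q m₂ ζ₀ →
  ∃ m₁' m₂' m₁'' m₂'' : ℕ, 0 < m₁' ∧ 0 < m₂' ∧ 0 < m₁'' ∧ 0 < m₂'' ∧
    (¬ (pow p m₁ μ₀).Dom → m₁' ≠ m₁'') ∧
    (∃ b' ∈ pow p m₁' μ₀, ∃ c' ∈ pow p m₂' ζ₀, ∃ b'' ∈ pow p m₁'' μ₀, ∃ c'' ∈ pow p m₂'' ζ₀,
      SameQFType lang ![η₀, b, c] ![η₀, b', c'] ∧
      SameQFType lang ![η₀, b, c] ![η₀, b'', c'']) ∧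
    ∀ k : ℕ, IsLeast {k : ℕ | MeetsDiffer q μ₀ k} k →
      m₁ ≡ m₁' [MOD k] ∧ m₁ ≡ m₁'' [MOD k]

end MeetTree

/-! Existence: by homogeneity `p` extends to an automorphism of `T`, which restricts to the
substructure generated by the orbits of `p.Dom`.

Uniqueness: a meet-tree is determined over its generators by the relation a ∧ b ≤ c
(`IsMeetTree.exists_equiv_closure`), so orbit points of two strict extensions must be shown to
satisfy the same such relations. Each involves three points; after a shift to nonnegative exponents
it is realised by an automorphism of `T` extending `p`. It remains to see that automorphisms f, g
agreeing on D = `p.Dom` have finite orbit segments of the same type over D. For this, g is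
conjugated, one point at a time, into agreement with f (`OrderPEC.exists_conj`,
`OrderPEC.exists_aut_orbits`).

The core is `OrderPEC.exists_aut`: if e ∈ f(D) \ D, then f e and g e have the same type over D ∪
f(D). Over f(D) this is automatic, because g f⁻¹ fixes f(D). The remaining points of D are initial
points η. By homogeneity, every point with the type of f e over f(D) is the next orbit point for
some extension of f|D. If η cut this type, next points could be placed on chosen sides of η; but PEC
provides earlier orbit points, already in f(D), that compare with η in the same way. Two witnesses,
congruent to the given exponent modulo the least splitting exponent, turn this into a contradiction
(`OrderPEC.false_of_below`, `OrderPEC.false_of_branch`). -/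

namespace MeetTree

/-! ### Automorphisms of semilinear meet-semilattices -/

section Orbits

universe u

variable {T : Type u} [SemilatticeInf T]

/-- A meet-semilattice whose principal lower sets are chains. -/
def Semilinear (T : Type u) [SemilatticeInf T] : Prop :=
  ∀ a b c : T, a ≤ c → b ≤ c → a ≤ b ∨ b ≤ a

/-- The meet of `a` with its image under `F ^ k` is moved by `F ^ k`. -/
def Splits (F : T ≃o T) (a : T) (k : ℕ) : Prop :=
  a ⊓ (F ^ k) a ≠ (F ^ k) a ⊓ (F ^ (2 * k)) a

theorem aut_mul_apply (F G : T ≃o T) (a : T) : (F * G) a = F (G a) := rfl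

theorem aut_one_apply (a : T) : (1 : T ≃o T) a = a := rfl

theorem aut_inv_apply_self (F : T ≃o T) (a : T) : F⁻¹ (F a) = a := by
  rw [← aut_mul_apply, inv_mul_cancel, aut_one_apply]

theorem aut_apply_inv_self (F : T ≃o T) (a : T) : F (F⁻¹ a) = a := by
  rw [← aut_mul_apply, mul_inv_cancel, aut_one_apply]

theorem aut_pow_add_apply (F : T ≃o T) (i j : ℕ) (a : T) :
    (F ^ (i + j)) a = (F ^ i) ((F ^ j) a) := by
  rw [pow_add, aut_mul_apply]

theorem aut_pow_succ_apply (F : T ≃o T) (i : ℕ) (a : T) :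
    (F ^ (i + 1)) a = F ((F ^ i) a) := by
  rw [pow_succ', aut_mul_apply]

theorem le_pow_of_le {g : T ≃o T} {a : T} (h : a ≤ g a) (i : ℕ) : a ≤ (g ^ i) a := by
  induction i with
  | zero => exact le_of_eq rfl
  | succ i ih =>
    rw [aut_pow_succ_apply]
    exact h.trans (g.monotone ih)

theorem pow_le_of_le {g : T ≃o T} {a : T} (h : g a ≤ a) (i : ℕ) : (g ^ i) a ≤ a := by
  induction i with
  | zero => exact le_of_eq rfl
  | succ i ih =>
    rw [aut_pow_succ_apply]
    exact (g.monotone ih).trans h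

theorem le_inv_of_le {g : T ≃o T} {a : T} (h : g a ≤ a) : a ≤ g⁻¹ a := by
  have := (g⁻¹).monotone h
  rwa [aut_inv_apply_self] at this

/-- The orbit branches off an ascending chain. Both `a ⊓ g ^ (i + 2) a` and `g (a ⊓ g a)` lie below
`g ^ (i + 2) a`, so they are comparable; were the latter smaller, it would lie below `a ⊓ g a`. -/
theorem inf_pow_of_ascending (hT : Semilinear T) {g : T ≃o T} {a : T}
    (h : a ⊓ g a < g (a ⊓ g a)) (i : ℕ) : a ⊓ (g ^ (i + 1)) a = a ⊓ g a := by
  induction i with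
  | zero => simp
  | succ i _ =>
    have h1 : g (a ⊓ g a) ≤ (g ^ (i + 1)) (a ⊓ g a) := by
      rw [aut_pow_succ_apply]
      exact g.monotone (le_pow_of_le h.le i)
    have h2 : g (a ⊓ g a) ≤ (g ^ (i + 1 + 1)) a := by
      refine h1.trans ?_
      rw [aut_pow_add_apply g (i + 1) 1, pow_one]
      exact (g ^ (i + 1)).monotone inf_le_right
    apply le_antisymm
    · rcases hT _ _ _ (inf_le_right : a ⊓ (g ^ (i + 1 + 1)) a ≤ _) h2 with h3 | h3
      · exact le_inf inf_le_left (h3.trans (g.monotone inf_le_left))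
      · exact absurd (le_inf (h3.trans inf_le_left) (g.monotone inf_le_left)) h.not_ge
    · exact le_inf inf_le_left (h.le.trans h2)

/-- This is the ascending case for `g⁻¹`, translated by a power of `g`. -/
theorem inf_pow_of_descending (hT : Semilinear T) {g : T ≃o T} {a : T}
    (h : g (a ⊓ g a) < a ⊓ g a) (i : ℕ) : a ⊓ (g ^ (i + 1)) a = (g ^ i) (a ⊓ g a) := by
  have e1 : a ⊓ g⁻¹ a = g⁻¹ (a ⊓ g a) := by
    rw [map_inf, aut_inv_apply_self, inf_comm]
  have h1 : a ⊓ g⁻¹ a < g⁻¹ (a ⊓ g⁻¹ a) := by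
    rw [e1]
    apply (g⁻¹).strictMono
    have := (g⁻¹).strictMono h
    rwa [aut_inv_apply_self] at this
  have h2 := congrArg (g ^ (i + 1)) (inf_pow_of_ascending hT h1 i)
  rw [e1, map_inf, ← aut_mul_apply, ← aut_mul_apply, inv_pow, mul_inv_cancel, aut_one_apply,
    pow_succ, mul_assoc, mul_inv_cancel, mul_one, inf_comm] at h2
  rw [pow_succ]
  exact h2

theorem lt_or_gt_of_splits (hT : Semilinear T) {F : T ≃o T} {a : T} {k : ℕ} (h : Splits F a k) :
    a ⊓ (F ^ k) a < (F ^ k) (a ⊓ (F ^ k) a) ∨ (F ^ k) (a ⊓ (F ^ k) a) < a ⊓ (F ^ k) a := by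
  have e : (F ^ k) (a ⊓ (F ^ k) a) = (F ^ k) a ⊓ (F ^ (2 * k)) a := by
    rw [map_inf, two_mul, aut_pow_add_apply]
  have hne : a ⊓ (F ^ k) a ≠ (F ^ k) (a ⊓ (F ^ k) a) := by
    rw [e]; exact h
  rcases hT (a ⊓ (F ^ k) a) ((F ^ k) (a ⊓ (F ^ k) a)) ((F ^ k) a) inf_le_right
    ((F ^ k).monotone inf_le_left) with h1 | h1
  · exact Or.inl (lt_of_le_of_ne h1 hne)
  · exact Or.inr (lt_of_le_of_ne h1 hne.symm)

theorem splits_of_le {F : T ≃o T} {a : T} {k : ℕ} (hne : (F ^ k) a ≠ a)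
    (h : a ≤ (F ^ k) a ∨ (F ^ k) a ≤ a) : Splits F a k := by
  intro h1
  rw [two_mul, aut_pow_add_apply] at h1
  rcases h with h | h
  · rw [inf_eq_left.2 h, inf_eq_left.2 ((F ^ k).monotone h)] at h1
    exact hne h1.symm
  · rw [inf_eq_right.2 h, inf_eq_right.2 ((F ^ k).monotone h)] at h1
    exact hne ((F ^ k).injective h1).symm

theorem Splits.pos {F : T ≃o T} {a : T} {k : ℕ} (h : Splits F a k) : 0 < k := by
  rcases Nat.eq_zero_or_pos k with rfl | h0
  · exact absurd rfl h
  · exact h0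

/-- Put g = F ^ k. Then a ≤ g ^ u a, so a is its own meet with g ^ u a, and the formulas for such
meets force a ≤ g a. -/
theorem Splits.le_of_le_pow (hT : Semilinear T) {F : T ≃o T} {a : T} {k u : ℕ} (h : Splits F a k)
    (hu : 0 < u) (h1 : a ≤ (F ^ u) a) : a ≤ (F ^ k) a := by
  have h2 : a ≤ ((F ^ k) ^ u) a := by
    rw [← pow_mul, mul_comm, pow_mul]
    exact le_pow_of_le h1 k
  obtain ⟨j, rfl⟩ : ∃ j, u = j + 1 := ⟨u - 1, by omega⟩
  rcases lt_or_gt_of_splits hT h with h3 | h3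
  · have h4 := inf_pow_of_ascending hT h3 j
    rw [inf_eq_left.2 h2] at h4
    exact inf_eq_left.1 h4.symm
  · have h4 := inf_pow_of_descending hT h3 j
    rw [inf_eq_left.2 h2] at h4
    have h5 : a ≤ a ⊓ (F ^ k) a := by
      conv_lhs => rw [h4]
      exact pow_le_of_le h3.le j
    exact h5.trans inf_le_right

theorem Splits.inv {F : T ≃o T} {a : T} {k : ℕ} (h : Splits F a k) : Splits F⁻¹ a k := by
  intro h1
  apply h
  have h2 := congrArg (F ^ (2 * k)) h1
  simp only [map_inf, ← aut_mul_apply, inv_pow, mul_inv_cancel, two_mul, pow_add,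
    mul_assoc, mul_inv_cancel_left, mul_one, aut_one_apply] at h2
  simp only [two_mul, pow_add]
  rw [inf_comm, ← h2, inf_comm]

theorem Splits.comparable (hT : Semilinear T) {F : T ≃o T} {a : T} {k u : ℕ} (h : Splits F a k)
    (hu : 0 < u) (h1 : a ≤ (F ^ u) a ∨ (F ^ u) a ≤ a) : a ≤ (F ^ k) a ∨ (F ^ k) a ≤ a := by
  rcases h1 with h1 | h1
  · exact Or.inl (h.le_of_le_pow hT hu h1)
  · have h2 : a ≤ (F⁻¹ ^ u) a := by
      rw [inv_pow]; exact le_inv_of_le h1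
    have h3 := h.inv.le_of_le_pow hT hu h2
    right
    have h4 := (F ^ k).monotone h3
    rwa [inv_pow, aut_apply_inv_self] at h4

/-- The exponents `i` for which `a` and `F ^ i (a)` are comparable form a subgroup. -/
def comparableExponents (hT : Semilinear T) (F : T ≃o T) (a : T) : AddSubgroup ℤ where
  carrier := {i | a ≤ (F ^ i) a ∨ (F ^ i) a ≤ a}
  zero_mem' := Or.inl (le_of_eq rfl)
  neg_mem' := by
    rintro i (h | h)
    · right
      have := (F ^ (-i)).monotone h
      rwa [← aut_mul_apply, ← zpow_add, neg_add_cancel, zpow_zero, aut_one_apply] at this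
    · left
      have := (F ^ (-i)).monotone h
      rwa [← aut_mul_apply, ← zpow_add, neg_add_cancel, zpow_zero, aut_one_apply] at this
  add_mem' := by
    have key : ∀ i j : ℤ, a ≤ (F ^ i) a → (F ^ j) a ≤ a →
        a ≤ (F ^ (i + j)) a ∨ (F ^ (i + j)) a ≤ a := by
      intro i j hi hj
      apply hT _ _ ((F ^ i) a) hi
      rw [zpow_add, aut_mul_apply]
      exact (F ^ i).monotone hj
    rintro i j (hi | hi) (hj | hj)
    · left
      rw [zpow_add, aut_mul_apply]
      exact hi.trans ((F ^ i).monotone hj)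
    · exact key i j hi hj
    · have := key j i hj hi
      rwa [add_comm] at this
    · right
      rw [zpow_add, aut_mul_apply]
      exact ((F ^ i).monotone hj).trans hi

/-- Comparable exponents form a group containing k and u, hence u % k. A nonzero comparable exponent
splits, since the orbit is not cyclic, so minimality of k forces u % k = 0. -/
theorem dvd_of_comparable (hT : Semilinear T) {F : T ≃o T} {a : T} {k u : ℕ}
    (hne : ∀ m : ℕ, 0 < m → (F ^ m) a ≠ a) (hk : IsLeast {k | Splits F a k} k)
    (hu : 0 < u) (h : a ≤ (F ^ u) a ∨ (F ^ u) a ≤ a) : k ∣ u := by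
  have hkc : (k : ℤ) ∈ comparableExponents hT F a := by
    have := Splits.comparable hT hk.1 hu h
    change a ≤ (F ^ (k : ℤ)) a ∨ (F ^ (k : ℤ)) a ≤ a
    rwa [zpow_natCast]
  have huc : (u : ℤ) ∈ comparableExponents hT F a := by
    change a ≤ (F ^ (u : ℤ)) a ∨ (F ^ (u : ℤ)) a ≤ a
    rwa [zpow_natCast]
  have hrc : ((u % k : ℕ) : ℤ) ∈ comparableExponents hT F a := by
    have e : ((u % k : ℕ) : ℤ) = u - (u / k : ℕ) • (k : ℤ) := by
      have := Nat.mod_add_div u k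
      rw [nsmul_eq_mul]
      zify at this ⊢
      linarith
    rw [e]
    exact sub_mem huc (nsmul_mem hkc _)
  have hrc' : a ≤ (F ^ (u % k)) a ∨ (F ^ (u % k)) a ≤ a := by
    change a ≤ (F ^ ((u % k : ℕ) : ℤ)) a ∨ (F ^ ((u % k : ℕ) : ℤ)) a ≤ a at hrc
    rwa [zpow_natCast] at hrc
  by_contra hd
  have hpos : 0 < u % k := Nat.pos_of_ne_zero fun h0 => hd (Nat.dvd_of_mod_eq_zero h0)
  have := hk.2 (splits_of_le (hne _ hpos) hrc')
  exact absurd (Nat.mod_lt u (Splits.pos hk.1)) this.not_gt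

end Orbits

end MeetTree

namespace MeetTree

/-! ### Consequences of pseudo existential closedness for orbits of initial points -/

section OrderPEC

universe u

variable {T : Type u} [SemilatticeInf T]

/-- The exponent `m'` lies within the restriction of `F` to `D`, is congruent to `m` modulo
the least splitting exponent of `ζ`, and `F ^ m (ζ)`, `F ^ m' (ζ)` compare with `η` alike. -/
structure Witness (D : Set T) (F : T ≃o T) (η ζ : T) (m m' : ℕ) : Prop where
  mem : ∀ i < m', (F ^ i) ζ ∈ D
  le_iff : η ≤ (F ^ m') ζ ↔ η ≤ (F ^ m) ζ
  ge_iff : (F ^ m') ζ ≤ η ↔ (F ^ m) ζ ≤ η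
  modEq : ∀ k, IsLeast {k | Splits F ζ k} k → m ≡ m' [MOD k]

/-- The consequence for binary order types of pseudo existential closedness
of the restriction of `f` to `D`. -/
def OrderPEC (D : Set T) (f : T ≃o T) : Prop :=
  ∀ F : T ≃o T, Set.EqOn F f D → ∀ η ∈ D \ f '' D, ∀ ζ ∈ D \ f '' D, ∀ m : ℕ,
    ¬ (∀ i < m, (F ^ i) ζ ∈ D) →
    ∃ m' m'', 0 < m' ∧ m' < m'' ∧ Witness D F η ζ m m' ∧ Witness D F η ζ m m''

/-- Adding range points creates no new non-cyclic initial points, so the property survives the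
growth of the domain. -/
theorem OrderPEC.mono {D E : Set T} {f : T ≃o T} (h : OrderPEC D f) (hDE : D ⊆ E)
    (hE : E ⊆ D ∪ f '' D) : OrderPEC E f := by
  have hsub : E \ f '' E ⊆ D \ f '' D := by
    rintro a ⟨ha, ha'⟩
    have h1 : a ∉ f '' D := fun h => ha' (Set.image_mono hDE h)
    exact ⟨(hE ha).resolve_right h1, h1⟩
  have hW : ∀ F η ζ m m', Witness D F η ζ m m' → Witness E F η ζ m m' :=
    fun F η ζ m m' w => ⟨fun i hi => hDE (w.mem i hi), w.le_iff, w.ge_iff, w.modEq⟩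
  intro F hF η hη ζ hζ m hm
  obtain ⟨m', m'', h1, h2, h3, h4⟩ := h F (hF.mono hDE) η (hsub hη) ζ (hsub hζ) m
    fun h' => hm fun i hi => hDE (h' i hi)
  exact ⟨m', m'', h1, h2, hW _ _ _ _ _ h3, hW _ _ _ _ _ h4⟩

theorem pow_apply_eq_of_eqOn {D : Set T} {F f : T ≃o T} (hF : Set.EqOn F f D) {a : T} {m : ℕ}
    (h : ∀ i < m, (f ^ i) a ∈ D) : ∀ i ≤ m, (F ^ i) a = (f ^ i) a := by
  intro i
  induction i with
  | zero => exact fun _ => rfl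
  | succ i ih =>
    intro hi
    rw [aut_pow_succ_apply, aut_pow_succ_apply, ih (by omega), hF (h i (by omega))]

variable {D : Set T} {f : T ≃o T}

/-- A moved exponent of an initial point never returns to it. -/
theorem OrderPEC.pow_apply_ne (h : OrderPEC D f) {F : T ≃o T} (hF : Set.EqOn F f D) {η : T}
    (hη : η ∈ D \ f '' D) {m : ℕ} (hm : 0 < m) : (F ^ m) η ≠ η := by
  have key : ∀ m' : ℕ, 0 < m' → (∀ i < m', (F ^ i) η ∈ D) → (F ^ m') η ≠ η := by
    intro m' hm' hD heq
    obtain ⟨j, rfl⟩ : ∃ j, m' = j + 1 := ⟨m' - 1, by omega⟩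
    rw [aut_pow_succ_apply, hF (hD j (by omega))] at heq
    exact hη.2 ⟨_, hD j (by omega), heq⟩
  intro heq
  by_cases hD : ∀ i < m, (F ^ i) η ∈ D
  · exact key m hm hD heq
  · obtain ⟨m', m'', h1, h2, h3, h4⟩ := h F hF η hη η hη m hD
    exact key m' h1 h3.mem (le_antisymm (h3.ge_iff.2 heq.le) (h3.le_iff.2 heq.ge))

/-- The least splitting exponent is already visible inside D, so it is common to all extensions. -/
theorem OrderPEC.exists_isLeast_splits (h : OrderPEC D f) {F : T ≃o T} (hF : Set.EqOn F f D) {ζ : T}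
    (hζ : ζ ∈ D \ f '' D) {u : ℕ} (hu : Splits F ζ u) :
    ∃ k, (∀ i < 2 * k, (f ^ i) ζ ∈ D) ∧
      ∀ G : T ≃o T, Set.EqOn G f D → IsLeast {k | Splits G ζ k} k := by
  classical
  have hex : ∃ k, Splits F ζ k := ⟨u, hu⟩
  have hleast : IsLeast {k | Splits F ζ k} (Nat.find hex) :=
    ⟨Nat.find_spec hex, fun j hj => Nat.find_min' hex hj⟩
  set k := Nat.find hex
  have hk : 0 < k := Splits.pos hleast.1
  -- Otherwise apply PEC at exponent 2k: the witnesses are distinct positive multiples of k, so the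
  -- larger is at least 2k and its orbit segment stays in D.
  have hD : ∀ i < 2 * k, (F ^ i) ζ ∈ D := by
    by_contra hD
    obtain ⟨m', m'', h1, h2, h3, h4⟩ := h F hF ζ hζ ζ hζ _ hD
    have e1 : k ∣ m' := by
      have := h3.modEq k hleast
      exact (Nat.modEq_zero_iff_dvd.1 (this.symm.trans (by simp [Nat.ModEq])))
    have e2 : k ∣ m'' := by
      have := h4.modEq k hleast
      exact (Nat.modEq_zero_iff_dvd.1 (this.symm.trans (by simp [Nat.ModEq])))
    obtain ⟨a, rfl⟩ := e1
    obtain ⟨b, rfl⟩ := e2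
    have ha : 0 < a := Nat.pos_of_mul_pos_left h1
    have hab : a < b := Nat.lt_of_mul_lt_mul_left h2
    apply hD
    intro i hi
    exact h4.mem i (by nlinarith)
  have hfD : ∀ i < 2 * k, (f ^ i) ζ ∈ D := by
    intro i hi
    rw [pow_apply_eq_of_eqOn hF.symm hD i hi.le]
    exact hD i hi
  refine ⟨k, hfD, fun G hG => ?_⟩
  have hGF : ∀ j ≤ k, Splits G ζ j ↔ Splits F ζ j := by
    intro j hj
    have e := pow_apply_eq_of_eqOn hG hfD
    have e' := pow_apply_eq_of_eqOn hF hfD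
    simp only [Splits]
    rw [e j (by omega), e' j (by omega), e (2 * j) (by omega), e' (2 * j) (by omega)]
  refine ⟨(hGF k le_rfl).2 hleast.1, fun j hj => ?_⟩
  by_contra hlt
  exact hlt (hleast.2 ((hGF j (by omega)).1 hj))

/-- The orbit of the initial point `ζ` leaves `D` exactly after `N` steps. -/
structure LastExponent (D : Set T) (f : T ≃o T) (ζ : T) (N : ℕ) : Prop where
  initial : ζ ∈ D \ f '' D
  mem : ∀ i < N, (f ^ i) ζ ∈ D
  notMem : (f ^ N) ζ ∉ D

variable {ζ η : T} {N : ℕ}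

theorem LastExponent.pow_mem_image (hN : LastExponent D f ζ N) {m : ℕ} (h0 : 0 < m) (hm : m ≤ N) :
    (f ^ m) ζ ∈ f '' D := by
  obtain ⟨j, rfl⟩ : ∃ j, m = j + 1 := ⟨m - 1, by omega⟩
  exact ⟨_, hN.mem j (by omega), (aut_pow_succ_apply f j ζ).symm⟩

theorem OrderPEC.exists_witnesses (h : OrderPEC D f) (hN : LastExponent D f ζ N) {F : T ≃o T}
    (hF : Set.EqOn F f D) (hη : η ∈ D \ f '' D) :
    ∃ m' m'', 0 < m' ∧ m' < m'' ∧ m'' ≤ N ∧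
      Witness D F η ζ (N + 1) m' ∧ Witness D F η ζ (N + 1) m'' := by
  have e := pow_apply_eq_of_eqOn hF hN.mem
  obtain ⟨m', m'', h1, h2, h3, h4⟩ := h F hF η hη ζ hN.initial (N + 1) fun hD =>
    hN.notMem (by rw [← e N le_rfl]; exact hD N (by omega))
  refine ⟨m', m'', h1, h2, ?_, h3, h4⟩
  by_contra hlt
  exact hN.notMem (by rw [← e N le_rfl]; exact h4.mem N (by omega))

/-- If the next point of an orbit is above an initial point, then so is an element of the range. -/
theorem OrderPEC.exists_mem_image_ge (h : OrderPEC D f) (hN : LastExponent D f ζ N) {F : T ≃o T}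
    (hF : Set.EqOn F f D) (hη : η ∈ D \ f '' D) (hle : η ≤ (F ^ (N + 1)) ζ) :
    ∃ r ∈ f '' D, η ≤ r := by
  obtain ⟨m', m'', h1, h2, h3, h4, h5⟩ := h.exists_witnesses hN hF hη
  refine ⟨(f ^ m') ζ, hN.pow_mem_image h1 (by omega), ?_⟩
  rw [← pow_apply_eq_of_eqOn hF hN.mem m' (by omega)]
  exact h4.le_iff.2 hle

/-- The next point `xa` of an orbit cannot lie in the interval below `b` which is cut out by the
range when an initial point branches off in that interval above `xa` and below `xb`. -/
theorem OrderPEC.false_of_below (hT : Semilinear T) (h : OrderPEC D f) (hN : LastExponent D f ζ N)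
    {Fa Fb : T ≃o T} (hFa : Set.EqOn Fa f D) (hFb : Set.EqOn Fb f D) (hη : η ∈ D \ f '' D) {b : T}
    (hb : ¬ b ≤ η) (hR : ∀ r ∈ f '' D, b ≤ r ∨ b ⊓ r < (Fa ^ (N + 1)) ζ)
    (ha : (Fa ^ (N + 1)) ζ ≤ η) (hab : (Fa ^ (N + 1)) ζ ≤ b)
    (hxb : ¬ (Fb ^ (N + 1)) ζ ≤ η) (hxb' : (Fb ^ (N + 1)) ζ < b) : False := by
  have ea := pow_apply_eq_of_eqOn hFa hN.mem
  have eb := pow_apply_eq_of_eqOn hFb hN.mem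
  -- The witness is a range point below η, hence not above b, hence below the next point of Fa. So a
  -- power of Fa moves ζ upwards.
  obtain ⟨n, n', h1, h2, h3, h4, -⟩ := h.exists_witnesses hN hFa hη
  have hn : (Fa ^ n) ζ ≤ η := h4.ge_iff.2 ha
  have hnR : (Fa ^ n) ζ ∈ f '' D := by
    rw [ea n (by omega)]
    exact hN.pow_mem_image h1 (by omega)
  have hnb : b ⊓ (Fa ^ n) ζ < (Fa ^ (N + 1)) ζ :=
    (hR _ hnR).resolve_left fun h5 => hb (h5.trans hn)
  have hnx : (Fa ^ n) ζ ≤ (Fa ^ (N + 1)) ζ :=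
    (hT _ _ _ hn ha).resolve_right fun h5 => (le_inf hab h5).not_gt hnb
  obtain ⟨u, hu⟩ : ∃ u, N + 1 = n + u := ⟨N + 1 - n, by omega⟩
  have hup : ζ ≤ (Fa ^ u) ζ := by
    rw [hu, aut_pow_add_apply] at hnx
    exact (Fa ^ n).le_iff_le.1 hnx
  obtain ⟨k, hkD, hk⟩ := h.exists_isLeast_splits hFa hN.initial
    (splits_of_le (h.pow_apply_ne hFa hN.initial (by omega)) (Or.inl hup))
  have hka := hk Fa hFa
  have hkb := hk Fb hFb
  -- Upward motion at the least splitting exponent takes place inside D, so Fb shares it.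
  have hk1 : ζ ≤ (Fb ^ k) ζ := by
    rw [pow_apply_eq_of_eqOn hFb hkD k (by omega), ← pow_apply_eq_of_eqOn hFa hkD k (by omega)]
    exact Splits.le_of_le_pow hT hka.1 (by omega) hup
  -- The congruence modulo k puts this range point below the next point of Fb, so it is not above b.
  -- It is then below the next point of Fa, hence below η, although it must compare with η as the
  -- next point of Fb does.
  obtain ⟨l, l', g1, g2, g3, g4, -⟩ := h.exists_witnesses hN hFb hη
  have hlx : (Fb ^ l) ζ ≤ (Fb ^ (N + 1)) ζ := by
    obtain ⟨j, hj⟩ := (Nat.modEq_iff_dvd' (by omega)).1 (g4.modEq k hkb).symm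
    have e : N + 1 = l + k * j := by omega
    rw [e, aut_pow_add_apply, pow_mul]
    exact (Fb ^ l).monotone (le_pow_of_le hk1 j)
  have hlR : (Fb ^ l) ζ ∈ f '' D := by
    rw [eb l (by omega)]
    exact hN.pow_mem_image g1 (by omega)
  rcases hR _ hlR with h5 | h5
  · exact hxb'.not_ge (h5.trans hlx)
  · rw [inf_eq_right.2 (hlx.trans hxb'.le)] at h5
    exact hxb (g4.ge_iff.1 (h5.le.trans ha))

/-- The next point of an orbit cannot branch off below `b` both at or above and strictly below
an initial point `η` which the range does not separate from `b`. -/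
theorem OrderPEC.false_of_branch (hT : Semilinear T) (h : OrderPEC D f) (hN : LastExponent D f ζ N)
    {Fa Fb : T ≃o T} (hFa : Set.EqOn Fa f D) (hFb : Set.EqOn Fb f D) (hη : η ∈ D \ f '' D) {b : T}
    (hR : ∀ r ∈ f '' D, η ≤ r → b ≤ r)
    (ha : η ≤ (Fa ^ (N + 1)) ζ) (hab : ¬ b ≤ (Fa ^ (N + 1)) ζ)
    (hxb : ¬ η ≤ (Fb ^ (N + 1)) ζ) : False := by
  have ea := pow_apply_eq_of_eqOn hFa hN.mem
  have eb := pow_apply_eq_of_eqOn hFb hN.mem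
  obtain ⟨n, n', h1, h2, h3, h4, h5⟩ := h.exists_witnesses hN hFa hη
  have hn : η ≤ (Fa ^ n) ζ := h4.le_iff.2 ha
  have hn' : η ≤ (Fa ^ n') ζ := h5.le_iff.2 ha
  by_cases hsplit : ∃ k, Splits Fb ζ k
  · obtain ⟨u, hu⟩ := hsplit
    obtain ⟨k, hkD, hk⟩ := h.exists_isLeast_splits hFb hN.initial hu
    have hka := hk Fa hFa
    have hkb := hk Fb hFb
    have hk0 : 0 < k := Splits.pos hka.1
    -- The quotient is positive because m < N + 1, as the formulas for meets along an orbit require.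
    have hdiv : ∀ {m}, m ≤ N → N + 1 ≡ m [MOD k] → ∃ j, N + 1 = m + k * (j + 1) := by
      intro m hm hmod
      obtain ⟨j, hj⟩ := (Nat.modEq_iff_dvd' (by omega)).1 hmod.symm
      have : j ≠ 0 := by
        rintro rfl
        omega
      obtain ⟨i, rfl⟩ := Nat.exists_eq_succ_of_ne_zero this
      exact ⟨i, by simp only [Nat.succ_eq_add_one] at hj; omega⟩
    obtain ⟨i, hi⟩ := hdiv (by omega) (h4.modEq k hka)
    obtain ⟨i', hi'⟩ := hdiv h3 (h5.modEq k hka)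
    rcases lt_or_gt_of_splits hT hka.1 with h6 | h6
    · obtain ⟨s, hs⟩ : ∃ s, i = s + 1 + i' := by
        have : k * (i' + 1) < k * (i + 1) := by omega
        have := Nat.lt_of_mul_lt_mul_left this
        exact ⟨i - i' - 1, by omega⟩
      have en' : n' = n + k * (s + 1) := by
        subst hs
        nlinarith
      -- In the ascending case the next point branches off the n-th one where the n'-th one does,
      -- and that meet is above b.
      have e1 : (Fa ^ n) ζ ⊓ (Fa ^ (N + 1)) ζ = (Fa ^ n) ζ ⊓ (Fa ^ n') ζ := by
        rw [hi, en', aut_pow_add_apply, aut_pow_add_apply, pow_mul, pow_mul, ← map_inf, ← map_inf,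
          inf_pow_of_ascending hT h6, inf_pow_of_ascending hT h6]
      have hbr : ∀ m, 0 < m → m ≤ N → η ≤ (Fa ^ m) ζ → b ≤ (Fa ^ m) ζ := by
        intro m hm hmN hle
        rw [ea m hmN] at hle ⊢
        exact hR _ (hN.pow_mem_image hm hmN) hle
      apply hab
      have h7 := le_inf (hbr n h1 (by omega) hn) (hbr n' (by omega) h3 hn')
      rw [← e1] at h7
      exact h7.trans inf_le_right
    -- In the descending case the next point meets all earlier points of its residue class in the
    -- same element. The class contains the witness for Fb, which is therefore above η.
    · have key : ∀ m j, N + 1 = m + k * (j + 1) → (Fa ^ m) ζ ⊓ (Fa ^ (N + 1)) ζ =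
          (Fa ^ (N + 1 - k)) (ζ ⊓ (Fa ^ k) ζ) := by
        intro m j hj
        have e : N + 1 - k = m + k * j := by
          rw [hj]
          have : k * (j + 1) = k * j + k := by ring
          omega
        rw [e, hj, aut_pow_add_apply, pow_mul, ← map_inf, inf_pow_of_descending hT h6,
          aut_pow_add_apply, pow_mul]
      obtain ⟨l, l', g1, g2, g3, g4, -⟩ := h.exists_witnesses hN hFb hη
      obtain ⟨j, hj⟩ := hdiv (by omega) (g4.modEq k hkb)
      apply hxb
      rw [← g4.le_iff, eb l (by omega), ← ea l (by omega)]
      have h7 := le_inf hn ha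
      rw [key n i hi, ← key l j hj] at h7
      exact h7.trans inf_le_left
  · obtain ⟨u, hu⟩ : ∃ u, N + 1 = u + n := ⟨N + 1 - n, by omega⟩
    obtain ⟨u', hu'⟩ : ∃ u', N + 1 = u' + n' := ⟨N + 1 - n', by omega⟩
    obtain ⟨m, hm⟩ : ∃ m, n' = n + m := ⟨n' - n, by omega⟩
    -- Without splitting of ζ, the orbit of η is used instead: η and its u-th image both lie below
    -- the next point of Fa.
    have hcomp : η ≤ (Fa ^ u) η ∨ (Fa ^ u) η ≤ η := by
      refine hT _ _ _ ha ?_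
      rw [hu, aut_pow_add_apply]
      exact (Fa ^ u).monotone hn
    obtain ⟨k, hkD, hk⟩ := h.exists_isLeast_splits hFa hη
      (splits_of_le (h.pow_apply_ne hFa hη (m := u) (by omega)) hcomp)
    have hka := hk Fa hFa
    have hku : k ∣ u := dvd_of_comparable hT (fun m hm => h.pow_apply_ne hFa hη hm) hka
      (by omega) hcomp
    have hkc : η ≤ (Fb ^ k) η ∨ (Fb ^ k) η ≤ η := by
      rw [pow_apply_eq_of_eqOn hFb hkD k (by omega), ← pow_apply_eq_of_eqOn hFa hkD k (by omega)]
      exact Splits.comparable hT hka.1 (by omega) hcomp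
    obtain ⟨a, rfl⟩ := hku
    have hnb : η ≤ (Fb ^ n) ζ := by
      rwa [eb n (by omega), ← ea n (by omega)]
    have hnb' : η ≤ (Fb ^ n') ζ := by
      rwa [eb n' h3, ← ea n' h3]
    apply hxb
    rw [hu, aut_pow_add_apply]
    rcases hkc with h6 | h6
    · refine le_trans ?_ ((Fb ^ (k * a)).monotone hnb)
      rw [pow_mul]
      exact le_pow_of_le h6 a
    -- When η moves down, the meet of the two witnesses serves: it is above η, and non-splitting at
    -- m = n' - n makes it fixed by Fb ^ m.
    · have hfix : (Fb ^ m) ((Fb ^ n) ζ ⊓ (Fb ^ n') ζ) = (Fb ^ n) ζ ⊓ (Fb ^ n') ζ := by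
        have h7 := not_not.1 (not_exists.1 hsplit m)
        have h8 := congrArg (Fb ^ n) h7
        rw [map_inf, map_inf, ← aut_pow_add_apply, ← aut_pow_add_apply, ← hm] at h8
        rw [map_inf, ← aut_pow_add_apply, ← aut_pow_add_apply, show m + n = n' by omega,
          show m + n' = n + 2 * m by omega, h8]
      have hfix' : ∀ j, (Fb ^ (m * j)) ((Fb ^ n) ζ ⊓ (Fb ^ n') ζ) = (Fb ^ n) ζ ⊓ (Fb ^ n') ζ := by
        intro j
        induction j with
        | zero => rfl
        | succ j ih => rw [mul_add, mul_one, aut_pow_add_apply, hfix, ih]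
      obtain ⟨t, rfl⟩ : ∃ t, m = t + 1 := ⟨m - 1, by omega⟩
      have hle : (Fb ^ (k * (a * t))) η ≤ η := by
        rw [pow_mul]
        exact pow_le_of_le h6 _
      have hfin : η ≤ (Fb ^ (k * a)) ((Fb ^ n) ζ ⊓ (Fb ^ n') ζ) := by
        rw [← (Fb ^ (k * (a * t))).le_iff_le, ← aut_pow_add_apply,
          show k * (a * t) + k * a = (t + 1) * (k * a) by ring, hfix']
        exact hle.trans (le_inf hnb hnb')
      exact hfin.trans ((Fb ^ (k * a)).monotone inf_le_left)

end OrderPEC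

end MeetTree

namespace MeetTree

/-! ### One-point types in the generic order -/

section GenericOrder

universe u

variable {T : Type u} [SemilatticeInf T]

/-- The properties of the countable generic meet-tree, as an ordered set, which are used:
it is semilinear, homogeneous, dense, without minimal elements, and infinitely branching. -/
structure IsGenericOrder (T : Type u) [SemilatticeInf T] : Prop where
  semilinear : Semilinear T
  homogeneous : ∀ s : Set (T × T), s.Finite →
    (∀ a ∈ s, ∀ b ∈ s, ∀ c ∈ s, a.1 ⊓ b.1 ≤ c.1 ↔ a.2 ⊓ b.2 ≤ c.2) →
    ∃ F : T ≃o T, ∀ a ∈ s, F a.1 = a.2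
  dense : ∀ a b : T, a < b → ∃ c, a < c ∧ c < b
  exists_lt : ∀ a : T, ∃ b, b < a
  exists_branch : ∀ S : Set T, S.Finite → ∀ c : T, ∃ x, c < x ∧ ∀ s ∈ S, x ⊓ s ≤ c

namespace IsGenericOrder

variable (hT : IsGenericOrder T)

include hT

theorem exists_aut_fixing {S : Set T} (hS : S.Finite) {x y : T}
    (h1 : ∀ s ∈ S, ∀ t ∈ S, x ⊓ s ≤ t ↔ y ⊓ s ≤ t)
    (h2 : ∀ s ∈ S, ∀ t ∈ S, s ⊓ t ≤ x ↔ s ⊓ t ≤ y)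
    (h3 : ∀ s ∈ S, x ≤ s ↔ y ≤ s) :
    ∃ F : T ≃o T, (∀ s ∈ S, F s = s) ∧ F x = y := by
  obtain ⟨F, hF⟩ := hT.homogeneous (insert (x, y) ((fun s => (s, s)) '' S))
    ((hS.image _).insert _) (by
      rintro a (rfl | ⟨a, ha, rfl⟩) b (rfl | ⟨b, hb, rfl⟩) c (rfl | ⟨c, hc, rfl⟩)
      · simp
      · simpa using h3 c hc
      · simp
      · exact h1 b hb c hc
      · simp
      · simpa only [inf_comm] using h1 a ha c hc
      · exact h2 a ha b hb
      · exact Iff.rfl)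
  exact ⟨F, fun s hs => hF (s, s) (Or.inr ⟨s, hs, rfl⟩), hF (x, y) (Or.inl rfl)⟩

/-- A point branching off from S at or below c, while itself above c, meets each s in c ⊓ s; its
type over S therefore depends only on c. -/
theorem exists_aut_of_cone {S : Set T} (hS : S.Finite) {x y c : T} (hx : c < x) (hy : c < y)
    (hxs : ∀ s ∈ S, x ⊓ s ≤ c) (hys : ∀ s ∈ S, y ⊓ s ≤ c) :
    ∃ F : T ≃o T, (∀ s ∈ S, F s = s) ∧ F x = y := by
  have ex : ∀ s ∈ S, x ⊓ s = c ⊓ s := fun s hs =>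
    le_antisymm (le_inf (hxs s hs) inf_le_right) (inf_le_inf_right s hx.le)
  have ey : ∀ s ∈ S, y ⊓ s = c ⊓ s := fun s hs =>
    le_antisymm (le_inf (hys s hs) inf_le_right) (inf_le_inf_right s hy.le)
  refine hT.exists_aut_fixing hS (fun s hs t _ => by rw [ex s hs, ey s hs])
    (fun s hs t _ => ?_) (fun s hs => ?_)
  · have e : ∀ z, s ⊓ t ≤ z ↔ s ⊓ t ≤ z ⊓ s := fun z =>
      ⟨fun h => le_inf h inf_le_left, fun h => h.trans inf_le_left⟩
    rw [e x, e y, ex s hs, ey s hs]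
  · refine iff_of_false (fun h => ?_) (fun h => ?_)
    · exact (hxs s hs).not_gt (by rwa [inf_eq_left.2 h])
    · exact (hys s hs).not_gt (by rwa [inf_eq_left.2 h])

/-- For s above b the meet x ⊓ s is x ⊓ b, and for other s it is b ⊓ s. Hence the type of x over S
depends only on b and on whether x ≤ b. -/
theorem exists_aut_of_gap {S : Set T} (hS : S.Finite) {x y b : T} (hx : ¬ b ≤ x) (hy : ¬ b ≤ y)
    (hxy : x ≤ b ↔ y ≤ b) (hxs : ∀ s ∈ S, b ≤ s ∨ b ⊓ s < x ⊓ b)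
    (hys : ∀ s ∈ S, b ≤ s ∨ b ⊓ s < y ⊓ b) :
    ∃ F : T ≃o T, (∀ s ∈ S, F s = s) ∧ F x = y := by
  have e1 : ∀ z s : T, ¬ b ≤ z → b ≤ s → z ⊓ s = z ⊓ b := by
    intro z s hz hs
    apply le_antisymm _ (inf_le_inf_left z hs)
    rcases hT.semilinear (z ⊓ s) b s inf_le_right hs with h | h
    · exact le_inf inf_le_left h
    · exact absurd (h.trans inf_le_left) hz
  have e2 : ∀ z s : T, b ⊓ s < z ⊓ b → z ⊓ s = b ⊓ s := by
    intro z s h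
    apply le_antisymm
    · rcases hT.semilinear (z ⊓ s) (z ⊓ b) z inf_le_left inf_le_left with h' | h'
      · exact le_inf (h'.trans inf_le_right) inf_le_right
      · exact absurd (le_inf inf_le_right (h'.trans inf_le_right)) h.not_ge
    · exact le_inf (h.le.trans inf_le_left) inf_le_right
  have e3 : ∀ z s : T, b ⊓ s < z ⊓ b → ¬ z ⊓ b ≤ s := fun z s h h' =>
    h.not_ge (le_inf inf_le_right h')
  have e4 : ∀ s ∈ S, ¬ b ≤ s → b ⊓ s < x ⊓ b ∧ b ⊓ s < y ⊓ b := fun s hs h =>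
    ⟨(hxs s hs).resolve_left h, (hys s hs).resolve_left h⟩
  have e5 : ∀ z s t : T, s ⊓ t ≤ z ↔ s ⊓ t ≤ z ⊓ s := fun z s t =>
    ⟨fun h => le_inf h inf_le_left, fun h => h.trans inf_le_left⟩
  refine hT.exists_aut_fixing hS (fun s hs t ht => ?_) (fun s hs t ht => ?_) (fun s hs => ?_)
  · by_cases hbs : b ≤ s
    · rw [e1 x s hx hbs, e1 y s hy hbs]
      by_cases hbt : b ≤ t
      · exact iff_of_true (inf_le_right.trans hbt) (inf_le_right.trans hbt)
      · exact iff_of_false (e3 x t (e4 t ht hbt).1) (e3 y t (e4 t ht hbt).2)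
    · rw [e2 x s (e4 s hs hbs).1, e2 y s (e4 s hs hbs).2]
  · by_cases hbs : b ≤ s
    · by_cases hbt : b ≤ t
      · exact iff_of_false (fun h => hx ((le_inf hbs hbt).trans h))
          (fun h => hy ((le_inf hbs hbt).trans h))
      · rw [inf_comm, e5 x, e5 y, e2 x t (e4 t ht hbt).1, e2 y t (e4 t ht hbt).2]
    · rw [e5 x, e5 y, e2 x s (e4 s hs hbs).1, e2 y s (e4 s hs hbs).2]
  · by_cases hbs : b ≤ s
    · rw [← inf_eq_left, e1 x s hx hbs, inf_eq_left, hxy, ← inf_eq_left (b := s),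
        e1 y s hy hbs, inf_eq_left]
    · exact iff_of_false (fun h => e3 x s (e4 s hs hbs).1 (inf_le_left.trans h))
        (fun h => e3 y s (e4 s hs hbs).2 (inf_le_left.trans h))

theorem exists_between_finite {L : Set T} (hL : L.Finite) {w : T} (h : ∀ l ∈ L, l < w) :
    ∃ x < w, ∀ l ∈ L, l < x := by
  induction L, hL using Set.Finite.induction_on with
  | empty =>
    obtain ⟨x, hx⟩ := hT.exists_lt w
    exact ⟨x, hx, by simp⟩
  | @insert a L _ _ ih =>
    obtain ⟨x, hx, hx'⟩ := ih fun l hl => h l (Or.inr hl)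
    obtain ⟨y, hy, hy'⟩ := hT.dense a w (h a (Or.inl rfl))
    rcases hT.semilinear x y w hx.le hy'.le with hxy | hxy
    · exact ⟨y, hy', by rintro l (rfl | hl); exacts [hy, (hx' l hl).trans_le hxy]⟩
    · exact ⟨x, hx, by rintro l (rfl | hl); exacts [hy.trans_le hxy, hx' l hl]⟩

end IsGenericOrder

/-! ### The next orbit point has a determined type -/

theorem exists_lastExponent {D : Set T} (hD : D.Finite) {f : T ≃o T} {e : T} (he : e ∈ f '' D)
    (he' : e ∉ D) : ∃ ζ N, LastExponent D f ζ N ∧ (f ^ N) ζ = e := by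
  classical
  have hback : ∀ i j, (f ^ i) ((f⁻¹ ^ (i + j)) e) = (f⁻¹ ^ j) e := by
    intro i j
    rw [← aut_mul_apply, pow_add, inv_pow, mul_inv_cancel_left]
  -- A backward orbit staying in the finite set D would be cyclic and return to e, which is outside
  -- D.
  have hex : ∃ i, (f⁻¹ ^ (i + 1)) e ∉ D := by
    by_contra! hall
    have hni : ¬ Function.Injective fun i : ℕ => (f⁻¹ ^ (i + 1)) e := fun hinj =>
      (Set.infinite_of_injective_forall_mem hinj hall) hD
    have key : ∀ i j : ℕ, i < j → (f⁻¹ ^ (i + 1)) e = (f⁻¹ ^ (j + 1)) e → False := by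
      intro i j hij h
      obtain ⟨d, rfl⟩ : ∃ d, j = i + (d + 1) := ⟨j - i - 1, by omega⟩
      have h2 := hback (i + 1) (d + 1)
      rw [show i + 1 + (d + 1) = i + (d + 1) + 1 by omega, ← h] at h2
      have h3 := hback (i + 1) 0
      rw [add_zero, h2] at h3
      exact he' (by simpa using (h3 ▸ hall d : (f⁻¹ ^ 0) e ∈ D))
    apply hni
    intro i j h
    rcases lt_trichotomy i j with h1 | h1 | h1
    · exact (key i j h1 h).elim
    · exact h1
    · exact (key j i h1 h.symm).elim
  have hmin : ∀ i < Nat.find hex, (f⁻¹ ^ (i + 1)) e ∈ D := fun i hi =>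
    not_not.1 (Nat.find_min hex hi)
  have hspec := Nat.find_spec hex
  set M := Nat.find hex
  have hM : M ≠ 0 := by
    intro h0
    rw [h0] at hspec
    obtain ⟨a, ha, rfl⟩ := he
    apply hspec
    rw [zero_add, pow_one, aut_inv_apply_self]
    exact ha
  refine ⟨(f⁻¹ ^ M) e, M, ⟨⟨?_, ?_⟩, fun i hi => ?_, ?_⟩, ?_⟩
  · have := hmin (M - 1) (by omega)
    rwa [Nat.sub_add_cancel (by omega)] at this
  · rintro ⟨a, ha, h⟩
    apply hspec
    rw [aut_pow_succ_apply, ← h, aut_inv_apply_self]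
    exact ha
  · have h1 := hback i (M - i)
    rw [Nat.add_sub_cancel' hi.le] at h1
    rw [h1]
    have := hmin (M - i - 1) (by omega)
    rwa [Nat.sub_add_cancel (by omega)] at this
  · have h1 := hback M 0
    rw [add_zero] at h1
    rw [h1]
    exact he'
  · exact hback M 0

/-- The type over f(D) is either a cone above an element of its meet-closure, or a gap below such an
element. In both cases no initial point may cut it. -/
theorem OrderPEC.exists_aut (hT : IsGenericOrder T) {D : Set T} (hD : D.Finite) {f g : T ≃o T}
    (hf : OrderPEC D f) (hfg : Set.EqOn g f D) {e : T} (he : e ∈ f '' D) (he' : e ∉ D) :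
    ∃ h : T ≃o T, (∀ a ∈ D ∪ f '' D, h a = a) ∧ h (f e) = g e := by
  obtain ⟨ζ, N, hN, hNe⟩ := exists_lastExponent hD he he'
  have hR : (f '' D).Finite := hD.image f
  have hDR : (D ∪ f '' D).Finite := hD.union hR
  have hA : ∀ a ∈ D ∪ f '' D, a ∈ f '' D ∨ a ∈ D \ f '' D := by
    rintro a (ha | ha)
    · by_cases h : a ∈ f '' D
      exacts [Or.inl h, Or.inr ⟨ha, h⟩]
    · exact Or.inl ha
  -- Composing f with an automorphism fixing f(D) keeps f on D and redirects only what follows e.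
  have hmove : ∀ x, (∃ k : T ≃o T, (∀ r ∈ f '' D, k r = r) ∧ k (f e) = x) →
      ∃ F : T ≃o T, Set.EqOn F f D ∧ (F ^ (N + 1)) ζ = x := by
    rintro x ⟨k, hk, rfl⟩
    have hF : Set.EqOn (k * f) f D := fun a ha => hk _ ⟨a, ha, rfl⟩
    refine ⟨k * f, hF, ?_⟩
    rw [aut_pow_succ_apply, pow_apply_eq_of_eqOn hF hN.mem N le_rfl, hNe, aut_mul_apply]
  obtain ⟨k, hk, hke⟩ : ∃ k : T ≃o T, (∀ r ∈ f '' D, k r = r) ∧ k (f e) = g e := by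
    refine ⟨g * f⁻¹, ?_, ?_⟩
    · rintro _ ⟨a, ha, rfl⟩
      rw [aut_mul_apply, aut_inv_apply_self]
      exact hfg ha
    · rw [aut_mul_apply, aut_inv_apply_self]
  have hkm : ∀ t ∈ infClosure (f '' D), k t = t := by
    have h1 : InfClosed {t : T | k t = t} := by
      intro a ha b hb
      change k (a ⊓ b) = a ⊓ b
      rw [map_inf, ha, hb]
    exact fun t ht => infClosure_min hk h1 ht
  obtain ⟨r₀, hr₀, hmax⟩ : ∃ r₀ ∈ f '' D, ∀ r ∈ f '' D, f e ⊓ r ≤ f e ⊓ r₀ := by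
    obtain ⟨r₀, hr₀, h⟩ := Set.Finite.exists_maximalFor (fun r => f e ⊓ r) _ hR ⟨e, he⟩
    refine ⟨r₀, hr₀, fun r hr => ?_⟩
    rcases hT.semilinear _ _ _ (inf_le_left : f e ⊓ r ≤ f e) (inf_le_left : f e ⊓ r₀ ≤ f e)
      with h1 | h1
    exacts [h1, h hr h1]
  by_cases hc : f e ⊓ r₀ ∈ infClosure (f '' D)
  · set c := f e ⊓ r₀
    by_cases hce : c = f e
    · refine ⟨1, fun _ _ => rfl, ?_⟩
      rw [← hke, ← hce, hkm c hc, aut_one_apply]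
    have hclt : c < f e := lt_of_le_of_ne inf_le_left hce
    have hclt' : c < g e := by
      rw [← hke, ← hkm c hc]
      exact k.strictMono hclt
    have hmax' : ∀ r ∈ f '' D, g e ⊓ r ≤ c := by
      intro r hr
      rw [← hke, ← hkm c hc, ← hk r hr, ← map_inf]
      exact k.monotone (hmax r hr)
    -- An initial point in a cone at c free of range points could have the next orbit point above
    -- it, and PEC would then put a range point in that cone.
    have hη : ∀ η ∈ D \ f '' D, c < η → ∃ r ∈ f '' D, ¬ η ⊓ r ≤ c := by
      intro η hη hcη
      by_contra! hall
      obtain ⟨x, hx, -⟩ := hT.exists_branch ∅ Set.finite_empty η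
      obtain ⟨F, hF, hFx⟩ := hmove x (hT.exists_aut_of_cone hR hclt (hcη.trans hx) hmax (by
        intro r hr
        rcases hT.semilinear _ _ _ (inf_le_left : x ⊓ r ≤ x) hx.le with h1 | h1
        · exact (le_inf h1 inf_le_right).trans (hall r hr)
        · exact absurd ((le_inf le_rfl (h1.trans inf_le_right)).trans (hall r hr)) hcη.not_ge))
      obtain ⟨r, hr, hle⟩ := hf.exists_mem_image_ge hN hF hη (hFx ▸ hx.le)
      have := hall r hr
      rw [inf_eq_left.2 hle] at this
      exact hcη.not_ge this
    have key : ∀ z, c < z → (∀ r ∈ f '' D, z ⊓ r ≤ c) → ∀ a ∈ D ∪ f '' D, z ⊓ a ≤ c := by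
      intro z hz hzr a ha
      rcases hA a ha with ha | ha
      · exact hzr a ha
      by_contra hlt
      have h1 : c < z ⊓ a := by
        rcases hT.semilinear _ _ _ (inf_le_left : z ⊓ a ≤ z) hz.le with h1 | h1
        exacts [absurd h1 hlt, lt_of_le_not_ge h1 hlt]
      obtain ⟨r, hr, hrc⟩ := hη a ha (h1.trans_le inf_le_right)
      rcases hT.semilinear _ _ _ (inf_le_right : z ⊓ a ≤ a) (inf_le_left : a ⊓ r ≤ a) with h2 | h2
      · exact hlt ((le_inf inf_le_left (h2.trans inf_le_right)).trans (hzr r hr))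
      · exact hrc ((le_inf (h2.trans inf_le_left) inf_le_right).trans (hzr r hr))
    exact hT.exists_aut_of_cone hDR hclt hclt' (key _ hclt hmax) (key _ hclt' hmax')
  -- Here b is the least element of the meet-closure above f e ⊓ r₀, that is, the upper end of the
  -- gap.
  · obtain ⟨b, ⟨hbm, hcb⟩, hbmin⟩ := Set.Finite.exists_minimalFor id
      {t | t ∈ infClosure (f '' D) ∧ f e ⊓ r₀ ≤ t} (hR.infClosure.subset fun t ht => ht.1)
      ⟨r₀, subset_infClosure hr₀, inf_le_right⟩
    have hbleast : ∀ t ∈ infClosure (f '' D), f e ⊓ r₀ ≤ t → b ≤ t := fun t ht hct =>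
      (hbmin ⟨infClosed_infClosure hbm ht, le_inf hcb hct⟩ inf_le_left).trans inf_le_right
    have hxb : f e ⊓ b = f e ⊓ r₀ := le_antisymm
      (inf_le_inf_left _ (hbleast r₀ (subset_infClosure hr₀) inf_le_right))
      (le_inf inf_le_left hcb)
    have hbx : ¬ b ≤ f e := by
      intro h
      rw [inf_eq_right.2 h] at hxb
      exact hc (hxb ▸ hbm)
    have hxR : ∀ r ∈ f '' D, b ≤ r ∨ b ⊓ r < f e ⊓ b := by
      intro r hr
      by_cases hcr : f e ⊓ r₀ ≤ r
      · exact Or.inl (hbleast r (subset_infClosure hr) hcr)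
      · right
        rcases hT.semilinear _ _ _ (inf_le_left : b ⊓ r ≤ b) (inf_le_right : f e ⊓ b ≤ b)
          with h1 | h1
        · exact lt_of_le_not_ge h1 fun h2 => hcr (hxb ▸ h2.trans inf_le_right)
        · exact absurd (hxb ▸ h1.trans inf_le_right) hcr
    have hby : ¬ b ≤ g e := by
      rw [← hke, ← hkm b hbm, k.le_iff_le]
      exact hbx
    have hxy : f e ≤ b ↔ g e ≤ b := by
      rw [← hke, ← k.le_iff_le, hkm b hbm]
    have hyR : ∀ r ∈ f '' D, b ≤ r ∨ b ⊓ r < g e ⊓ b := by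
      intro r hr
      refine (hxR r hr).imp_right fun h => ?_
      have := k.strictMono h
      rwa [map_inf, map_inf, hkm b hbm, hk r hr, hke] at this
    have hx : ∀ x, ¬ b ≤ x → (f e ≤ b ↔ x ≤ b) → (∀ r ∈ f '' D, b ≤ r ∨ b ⊓ r < x ⊓ b) →
        ∃ F : T ≃o T, Set.EqOn F f D ∧ (F ^ (N + 1)) ζ = x := fun x h1 h2 h3 =>
      hmove x (hT.exists_aut_of_gap hR hbx h1 h2 hxR h3)
    have hη : ∀ η ∈ D \ f '' D, b ≤ η ∨ ∃ r ∈ f '' D, ¬ b ≤ r ∧ b ⊓ η ≤ b ⊓ r := by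
      intro η hη
      by_contra! hall
      obtain ⟨hbη, hall⟩ := hall
      have hw : ∀ r ∈ f '' D, b ≤ r ∨ b ⊓ r < b ⊓ η := by
        intro r hr
        by_cases hbr : b ≤ r
        · exact Or.inl hbr
        · exact Or.inr (lt_of_le_not_ge ((hT.semilinear _ _ _ (inf_le_left : b ⊓ r ≤ b)
            (inf_le_left : b ⊓ η ≤ b)).resolve_right (hall r hr hbr)) (hall r hr hbr))
      have hwb : b ⊓ η < b := lt_of_le_of_ne inf_le_left fun h => hbη (inf_eq_left.1 h)
      -- The supposed η cuts the gap at b ⊓ η; c is a position in the gap strictly below this cut.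
      obtain ⟨c, hcw, hcL⟩ := hT.exists_between_finite
        (L := (fun r => b ⊓ r) '' {r | r ∈ f '' D ∧ ¬ b ≤ r})
        ((hR.subset fun r hr => hr.1).image _) (w := b ⊓ η) (by
          rintro _ ⟨r, ⟨hr, hbr⟩, rfl⟩
          exact (hw r hr).resolve_left hbr)
      have hcR : ∀ r ∈ f '' D, b ≤ r ∨ b ⊓ r < c := fun r hr =>
        or_iff_not_imp_left.2 fun hbr => hcL _ ⟨r, ⟨hr, hbr⟩, rfl⟩
      have hcb' : c < b := hcw.trans hwb
      -- If the type lies on the chain below b, next points on either side of b ⊓ η are compared.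
      -- Otherwise they branch off at η and at c when η ≤ b, and a single one above η suffices when
      -- η is not below b.
      by_cases hxle : f e ≤ b
      · obtain ⟨x, hwx, hxb'⟩ := hT.dense _ _ hwb
        obtain ⟨Fa, hFa, ha⟩ := hx c hcb'.not_ge (iff_of_true hxle hcb'.le) (by
          rwa [inf_eq_left.2 hcb'.le])
        obtain ⟨Fb, hFb, hb⟩ := hx x hxb'.not_ge (iff_of_true hxle hxb'.le) (by
          rw [inf_eq_left.2 hxb'.le]
          exact fun r hr => (hw r hr).imp_right fun h => h.trans hwx)
        exact hf.false_of_below hT.semilinear hN hFa hFb hη hbη (by rwa [ha])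
          (by rw [ha]; exact hcw.le.trans inf_le_right) (by rw [ha]; exact hcb'.le)
          (by rw [hb]; exact fun h => hwx.not_ge (le_inf hxb'.le h)) (by rwa [hb])
      · by_cases hηb : η ≤ b
        · rw [inf_eq_right.2 hηb] at hcw hw hwb
          obtain ⟨xa, hxa, hxa'⟩ := hT.exists_branch {b} (Set.finite_singleton b) η
          obtain ⟨xb, hxb, hxb'⟩ := hT.exists_branch {b} (Set.finite_singleton b) c
          have hxa' := hxa' b rfl
          have hxb' := hxb' b rfl
          have hbxa : ¬ b ≤ xa := fun h => hbη ((le_inf h le_rfl).trans hxa')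
          obtain ⟨Fa, hFa, ha⟩ := hx xa hbxa (iff_of_false hxle
            fun h => hxa.not_ge ((le_inf le_rfl h).trans hxa'))
            (fun r hr => (hw r hr).imp_right fun h => h.trans_le (le_inf hxa.le hηb))
          obtain ⟨Fb, hFb, hb⟩ := hx xb (fun h => hcb'.not_ge ((le_inf h le_rfl).trans hxb'))
            (iff_of_false hxle fun h => hxb.not_ge ((le_inf le_rfl h).trans hxb'))
            (fun r hr => (hcR r hr).imp_right fun h => h.trans_le (le_inf hxb.le hcb'.le))
          exact hf.false_of_branch hT.semilinear hN hFa hFb hη (b := b)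
            (fun r hr hle => (hw r hr).resolve_right fun h => h.not_ge (le_inf hηb hle))
            (by rw [ha]; exact hxa.le) (by rwa [ha])
            (by rw [hb]; exact fun h => hcw.not_ge ((le_inf h hηb).trans hxb'))
        · obtain ⟨x, hηx, -⟩ := hT.exists_branch ∅ Set.finite_empty η
          have hxη : x ⊓ b ≤ η := (hT.semilinear _ _ _ (inf_le_left : x ⊓ b ≤ x)
            hηx.le).resolve_right fun h => hηb (h.trans inf_le_right)
          obtain ⟨F, hF, hFx⟩ := hx x (fun h => hbη ((le_inf h le_rfl).trans hxη))
            (iff_of_false hxle fun h => hηb (hηx.le.trans h))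
            (fun r hr => (hw r hr).imp_right fun h =>
              h.trans_le (le_inf (inf_le_right.trans hηx.le) inf_le_left))
          obtain ⟨r, hr, hle⟩ := hf.exists_mem_image_ge hN hF hη (hFx ▸ hηx.le)
          rcases hw r hr with h1 | h1
          · exact (hT.semilinear _ _ _ h1 hle).elim hbη hηb
          · exact h1.not_ge (inf_le_inf_left b hle)
    have key : ∀ z, (∀ r ∈ f '' D, b ≤ r ∨ b ⊓ r < z ⊓ b) →
        ∀ a ∈ D ∪ f '' D, b ≤ a ∨ b ⊓ a < z ⊓ b := by
      intro z hz a ha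
      rcases hA a ha with ha | ha
      · exact hz a ha
      · refine (hη a ha).imp_right ?_
        rintro ⟨r, hr, hbr, hle⟩
        exact hle.trans_lt ((hz r hr).resolve_left hbr)
    exact hT.exists_aut_of_gap hDR hbx hby hxy (key _ hxR) (key _ hyR)

/-- Two automorphisms which agree on `D` can be conjugated so as to agree on further points
of the range. -/
theorem OrderPEC.exists_conj (hT : IsGenericOrder T) {D E : Set T} (hD : D.Finite) {f g : T ≃o T}
    (hf : OrderPEC D f) (hfg : Set.EqOn g f D) (hE : E.Finite) (hED : E ⊆ f '' D) :
    ∃ h : T ≃o T, (∀ a ∈ D, h a = a) ∧ Set.EqOn (h * g * h⁻¹) f (D ∪ E) := by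
  induction E, hE using Set.Finite.induction_on with
  | empty => exact ⟨1, fun _ _ => rfl, by simpa using hfg⟩
  | @insert e E _ hE ih =>
    obtain ⟨h, h1, h2⟩ := ih fun a ha => hED (Or.inr ha)
    have hEsub : E ⊆ f '' D := fun a ha => hED (Or.inr ha)
    by_cases he : e ∈ D ∪ E
    · refine ⟨h, h1, ?_⟩
      rwa [Set.union_insert, Set.insert_eq_of_mem he]
    · have hPEC := hf.mono (E := D ∪ E) Set.subset_union_left (Set.union_subset_union_right D hEsub)
      have hef : e ∈ f '' (D ∪ E) := Set.image_mono Set.subset_union_left (hED (Or.inl rfl))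
      -- Conjugation by k⁻¹ preserves the earlier agreement, since k fixes the current domain and
      -- its image, and it corrects the value at e.
      obtain ⟨k, hk1, hk2⟩ := hPEC.exists_aut hT (hD.union hE) h2 hef he
      have hinv : ∀ a, k a = a → k⁻¹ a = a := fun a ha => by
        conv_lhs => rw [← ha, aut_inv_apply_self]
      refine ⟨k⁻¹ * h, fun a ha => ?_, ?_⟩
      · rw [aut_mul_apply, h1 a ha]
        exact hinv a (hk1 a (Or.inl (Or.inl ha)))
      · have e1 : k⁻¹ * h * g * (k⁻¹ * h)⁻¹ = k⁻¹ * (h * g * h⁻¹) * k := by group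
        rw [e1, Set.union_insert]
        rintro a (rfl | ha)
        · rw [aut_mul_apply, aut_mul_apply, hk1 _ (Or.inr hef), ← hk2, aut_inv_apply_self]
        · rw [aut_mul_apply, aut_mul_apply, hk1 a (Or.inl ha), h2 ha]
          exact hinv _ (hk1 _ (Or.inr ⟨a, ha, rfl⟩))

/-- Two automorphisms which agree on `D` have the same types of finite segments of orbits. -/
theorem OrderPEC.exists_aut_orbits (hT : IsGenericOrder T) (n : ℕ) :
    ∀ {D : Set T} (_ : D.Finite) {f g : T ≃o T} (_ : OrderPEC D f) (_ : Set.EqOn g f D),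
    ∃ h : T ≃o T, (∀ a ∈ D, h a = a) ∧ ∀ a ∈ D, ∀ i ≤ n, h ((g ^ i) a) = (f ^ i) a := by
  induction n with
  | zero =>
    intro D _ f g _ _
    refine ⟨1, fun _ _ => rfl, fun a _ i hi => ?_⟩
    obtain rfl : i = 0 := by omega
    rfl
  | succ n ih =>
    intro D hD f g hf hfg
    -- Agreement on D ∪ f(D) lets the induction hypothesis start one step further along each orbit.
    obtain ⟨h, h1, h2⟩ := hf.exists_conj hT hD hfg (hD.image f) subset_rfl
    obtain ⟨k, k1, k2⟩ := ih (hD.union (hD.image f))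
      (hf.mono Set.subset_union_left subset_rfl) h2
    refine ⟨k * h, fun a ha => ?_, fun a ha i hi => ?_⟩
    · rw [aut_mul_apply, h1 a ha, k1 a (Or.inl ha)]
    · rcases i with _ | i
      · rw [aut_mul_apply, pow_zero, pow_zero, aut_one_apply, h1 a ha, k1 a (Or.inl ha)]
      · have h3 := k2 (f a) (Or.inr ⟨a, ha, rfl⟩) i (by omega)
        have hinv : h⁻¹ a = a := by
          conv_lhs => rw [← h1 a ha, aut_inv_apply_self]
        have h4 : ((h * g * h⁻¹) ^ (i + 1)) a = h ((g ^ (i + 1)) a) := by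
          rw [conj_pow, aut_mul_apply, aut_mul_apply, hinv]
        rw [aut_mul_apply, ← h4, pow_succ, aut_mul_apply, h2 (Or.inl ha), h3, pow_succ,
          aut_mul_apply]

end GenericOrder

end MeetTree

namespace MeetTree

open PartialAut

/-! ### Meet-trees as structures and as semilattices -/

section Structures

universe u v w

variable {A : Type u} {B : Type v} [lang.Structure A] [lang.Structure B]

/-- A meet-tree as a meet-semilattice. -/
abbrev IsMeetTree.semilatticeInf (h : IsMeetTree A) : SemilatticeInf A where
  le := le
  inf := meet
  le_refl := h.refl
  le_trans := h.trans
  le_antisymm := h.antisymm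
  inf_le_left := h.meet_le_left
  inf_le_right := h.meet_le_right
  le_inf a b c := h.le_meet b c a

theorem relMap_le (x : Fin 2 → A) :
    Structure.RelMap (L := lang) (M := A) RelationSymbol.le x ↔ le (x 0) (x 1) := by
  rw [le, show ![x 0, x 1] = x from by ext i; fin_cases i <;> rfl]

theorem funMap_meet (x : Fin 2 → A) :
    Structure.funMap (L := lang) (M := A) FunctionSymbol.meet x = meet (x 0) (x 1) := by
  rw [meet, show ![x 0, x 1] = x from by ext i; fin_cases i <;> rfl]

theorem map_le {F : Type*} [FunLike F A B] [StrongHomClass lang F A B] (φ : F) (a b : A) :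
    le (φ a) (φ b) ↔ le a b := by
  have h := StrongHomClass.map_rel φ (RelationSymbol.le : lang.Relations 2) ![a, b]
  rw [relMap_le, relMap_le] at h
  exact h

theorem map_meet {F : Type*} [FunLike F A B] [StrongHomClass lang F A B] (φ : F) (a b : A) :
    φ (meet a b) = meet (φ a) (φ b) := by
  have h := HomClass.map_fun φ (FunctionSymbol.meet : lang.Functions 2) ![a, b]
  rw [funMap_meet, funMap_meet] at h
  exact h

theorem coe_le {S : lang.Substructure A} (a b : S) : le a b ↔ le (a : A) (b : A) :=
  (map_le S.subtype a b).symm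

theorem coe_meet {S : lang.Substructure A} (a b : S) : (meet a b : S) = meet (a : A) (b : A) :=
  map_meet S.subtype a b

theorem meet_mem {S : lang.Substructure A} {a b : A} (ha : a ∈ S) (hb : b ∈ S) : meet a b ∈ S := by
  have := (meet (⟨a, ha⟩ : S) ⟨b, hb⟩).2
  rwa [coe_meet] at this

theorem closedUnder_of_meet {s : Set A} (h : ∀ a ∈ s, ∀ b ∈ s, meet a b ∈ s) {n : ℕ}
    (f : lang.Functions n) : ClosedUnder f s := by
  change FunctionSymbol n at f
  cases f
  intro x hx
  rw [funMap_meet]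
  exact h _ (hx 0) _ (hx 1)

theorem IsMeetTree.of_embedding (hB : IsMeetTree B) (φ : A ↪[lang] B) : IsMeetTree A where
  refl a := (map_le φ a a).1 (hB.refl _)
  antisymm a b h h' := φ.injective (hB.antisymm _ _ ((map_le φ a b).2 h) ((map_le φ b a).2 h'))
  trans a b c h h' := (map_le φ a c).1 (hB.trans _ _ _ ((map_le φ a b).2 h) ((map_le φ b c).2 h'))
  semilinear a b c h h' := by
    rw [← map_le φ a b, ← map_le φ b a]
    exact hB.semilinear _ _ _ ((map_le φ a c).2 h) ((map_le φ b c).2 h')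
  common_lower_bound a b := by
    refine ⟨meet a b, ?_, ?_⟩
    · rw [← map_le φ, map_meet]; exact hB.meet_le_left _ _
    · rw [← map_le φ, map_meet]; exact hB.meet_le_right _ _
  meet_le_left a b := by rw [← map_le φ, map_meet]; exact hB.meet_le_left _ _
  meet_le_right a b := by rw [← map_le φ, map_meet]; exact hB.meet_le_right _ _
  le_meet a b c h h' := by
    rw [← map_le φ, map_meet]
    exact hB.le_meet _ _ _ ((map_le φ c a).2 h) ((map_le φ c b).2 h')

theorem IsMeetTree.substructure (hA : IsMeetTree A) (S : lang.Substructure A) : IsMeetTree S :=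
  hA.of_embedding S.subtype

/-- An order isomorphism of meet-trees is an isomorphism of structures. -/
def IsMeetTree.equivOfOrder (hA : IsMeetTree A) (hB : IsMeetTree B) (e : A ≃ B)
    (he : ∀ a b, le (e a) (e b) ↔ le a b) : A ≃[lang] B where
  toEquiv := e
  map_fun' := by
    intro n f x
    change FunctionSymbol n at f
    cases f
    have h : ∀ c a, le c (e a) ↔ le (e.symm c) a := fun c a => by
      rw [← he, e.apply_symm_apply]
    erw [funMap_meet, funMap_meet]
    apply hB.antisymm
    · exact hB.le_meet _ _ _ ((he _ _).2 (hA.meet_le_left _ _)) ((he _ _).2 (hA.meet_le_right _ _))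
    · refine (h _ _).2 (hA.le_meet _ _ _ ((h _ _).1 ?_) ((h _ _).1 ?_))
      · exact hB.meet_le_left _ _
      · exact hB.meet_le_right _ _
  map_rel' := by
    intro n r x
    change RelationSymbol n at r
    cases r
    erw [relMap_le, relMap_le]
    exact he _ _

/-- Semilinearity makes pairwise meets closed under meet: a meet of four generators is already the
meet of two of them. -/
theorem IsMeetTree.exists_eq_meet (hA : IsMeetTree A) {ι : Type w} {u : ι → A} {x : A}
    (hx : x ∈ Substructure.closure lang (Set.range u)) : ∃ i j, x = meet (u i) (u j) := by
  let := hA.semilatticeInf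
  have hT : Semilinear A := hA.semilinear
  refine Substructure.closure_induction (p := fun x => ∃ i j, x = meet (u i) (u j)) hx ?_
    (fun f => closedUnder_of_meet ?_ f)
  · rintro _ ⟨i, rfl⟩
    exact ⟨i, i, (inf_idem (u i)).symm⟩
  · rintro _ ⟨i, j, rfl⟩ _ ⟨k, l, rfl⟩
    change ∃ i' j', (u i ⊓ u j) ⊓ (u k ⊓ u l) = u i' ⊓ u j'
    have key : u i ⊓ u j ≤ u k ⊓ u l ∨ u k ⊓ u l ≤ u i ⊓ u j →
        ∃ i' j', (u i ⊓ u j) ⊓ (u k ⊓ u l) = u i' ⊓ u j' := by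
      rintro (h | h)
      · exact ⟨i, j, inf_eq_left.2 h⟩
      · exact ⟨k, l, inf_eq_right.2 h⟩
    rcases hT (u i ⊓ u j) (u i ⊓ u k) (u i) inf_le_left inf_le_left with h | h
    · exact key (hT _ _ (u k) (h.trans inf_le_right) inf_le_left)
    rcases hT (u k ⊓ u l) (u i ⊓ u k) (u k) inf_le_left inf_le_right with h' | h'
    · exact key (hT _ _ (u i) inf_le_left (h'.trans inf_le_left))
    · exact ⟨i, k, le_antisymm (inf_le_inf inf_le_left inf_le_left) (le_inf h h')⟩

/-- The isomorphism type of a generated meet-tree over its generators is determined by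
the ternary relation `a ∧ b ≤ c` between generators. -/
theorem IsMeetTree.exists_equiv_closure (hA : IsMeetTree A) {ι : Type w} {u v : ι → A}
    (h : ∀ i j k, le (meet (u i) (u j)) (u k) ↔ le (meet (v i) (v j)) (v k))
    {S S' : lang.Substructure A} (hS : Substructure.closure lang (Set.range u) = S)
    (hS' : Substructure.closure lang (Set.range v) = S') :
    ∃ θ : S ≃[lang] S', ∀ i (hi : u i ∈ S), (θ ⟨u i, hi⟩ : A) = v i := by
  subst hS hS'
  let := hA.semilatticeInf
  have h' : ∀ i j k l, u i ⊓ u j ≤ u k ⊓ u l ↔ v i ⊓ v j ≤ v k ⊓ v l := fun i j k l => by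
    rw [le_inf_iff, le_inf_iff]
    exact and_congr (h i j k) (h i j l)
  have hu : ∀ x : Substructure.closure lang (Set.range u), ∃ i j, (x : A) = u i ⊓ u j :=
    fun x => hA.exists_eq_meet x.2
  have hv : ∀ x : Substructure.closure lang (Set.range v), ∃ i j, (x : A) = v i ⊓ v j :=
    fun x => hA.exists_eq_meet x.2
  choose ui uj hu using hu
  choose vi vj hv using hv
  have mu : ∀ i j, u i ⊓ u j ∈ Substructure.closure lang (Set.range u) := fun i j =>
    meet_mem (Substructure.subset_closure ⟨i, rfl⟩) (Substructure.subset_closure ⟨j, rfl⟩)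
  have mv : ∀ i j, v i ⊓ v j ∈ Substructure.closure lang (Set.range v) := fun i j =>
    meet_mem (Substructure.subset_closure ⟨i, rfl⟩) (Substructure.subset_closure ⟨j, rfl⟩)
  have heq : ∀ i j k l, u i ⊓ u j = u k ⊓ u l ↔ v i ⊓ v j = v k ⊓ v l := fun i j k l => by
    rw [le_antisymm_iff, le_antisymm_iff, h', h']
  let e : Substructure.closure lang (Set.range u) ≃ Substructure.closure lang (Set.range v) :=
    { toFun := fun x => ⟨_, mv (ui x) (uj x)⟩
      invFun := fun x => ⟨_, mu (vi x) (vj x)⟩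
      left_inv := fun x => by
        ext
        change u (vi _) ⊓ u (vj _) = x
        rw [hu x, heq]
        exact (hv ⟨_, mv (ui x) (uj x)⟩).symm
      right_inv := fun x => by
        ext
        change v (ui _) ⊓ v (uj _) = x
        rw [hv x, ← heq]
        exact (hu ⟨_, mu (vi x) (vj x)⟩).symm }
  refine ⟨(hA.substructure _).equivOfOrder (hA.substructure _) e fun x y => ?_, fun i hi => ?_⟩
  · rw [coe_le, coe_le]
    change v (ui x) ⊓ v (uj x) ≤ v (ui y) ⊓ v (uj y) ↔ (x : A) ≤ y
    rw [hu x, hu y, h']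
  · change v (ui ⟨u i, hi⟩) ⊓ v (uj ⟨u i, hi⟩) = v i
    rw [← inf_idem (v i), ← heq, ← hu ⟨u i, hi⟩, inf_idem]

theorem SameQFType.meet_le_iff {n : ℕ} {x y : Fin n → A} (h : SameQFType lang x y) (i j k : Fin n) :
    le (meet (x i) (x j)) (x k) ↔ le (meet (y i) (y j)) (y k) := by
  have := h (Relations.formula₂ (L := lang) RelationSymbol.le
    (Functions.apply₂ (L := lang) FunctionSymbol.meet (Term.var i) (Term.var j)) (Term.var k))
    (BoundedFormula.IsAtomic.rel _ _).isQF
  have key : ∀ z : Fin n → A, (Relations.formula₂ (L := lang) RelationSymbol.le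
      (Functions.apply₂ (L := lang) FunctionSymbol.meet (Term.var i) (Term.var j))
      (Term.var k)).Realize z ↔ le (meet (z i) (z j)) (z k) := by
    intro z
    refine Formula.realize_rel₂.trans ((relMap_le _).trans ?_)
    exact iff_of_eq (congrArg₂ (le (A := A)) Term.realize_functions_apply₂ rfl)
  rwa [key, key] at this

theorem SameQFType.le_iff (hA : IsMeetTree A) {n : ℕ} {x y : Fin n → A} (h : SameQFType lang x y)
    (i j : Fin n) : le (x i) (x j) ↔ le (y i) (y j) := by
  let := hA.semilatticeInf
  have := SameQFType.meet_le_iff h i i j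
  change x i ⊓ x i ≤ x j ↔ y i ⊓ y i ≤ y j at this
  rwa [inf_idem, inf_idem] at this

end Structures

/-! ### Order properties of the Fraïssé limit -/

section Fraisse

universe w

/-- The structure of a meet-semilattice. -/
abbrev structureOfSemilatticeInf (A : Type w) [SemilatticeInf A] : lang.Structure A where
  funMap := fun {_} f => match f with | .meet => fun x => x 0 ⊓ x 1
  RelMap := fun {_} r => match r with | .le => fun x => x 0 ≤ x 1

theorem isMeetTree_of_semilinear {A : Type w} [SemilatticeInf A] (h : Semilinear A) :
    letI := structureOfSemilatticeInf A
    IsMeetTree A :=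
  letI := structureOfSemilatticeInf A
  { refl := le_refl (α := A)
    antisymm := fun _ _ h1 h2 => le_antisymm (α := A) h1 h2
    trans := fun _ _ _ h1 h2 => le_trans (α := A) h1 h2
    semilinear := h
    common_lower_bound := fun a b => ⟨a ⊓ b, inf_le_left (α := A), inf_le_right (α := A)⟩
    meet_le_left := fun _ _ => inf_le_left (α := A)
    meet_le_right := fun _ _ => inf_le_right (α := A)
    le_meet := fun _ _ _ h1 h2 => le_inf (α := A) h1 h2 }

/-- The order on `Option α` with least element `none` and all other elements incomparable. -/
abbrev starSemilatticeInf (α : Type w) [DecidableEq α] : SemilatticeInf (Option α) where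
  le a b := a = none ∨ a = b
  inf a b := if a = b then a else none
  le_refl a := Or.inr rfl
  le_trans a b c := by rintro (rfl | rfl) h; exacts [Or.inl rfl, h]
  le_antisymm a b := by
    rintro (rfl | rfl) (h | h)
    exacts [h.symm, h.symm, rfl, rfl]
  inf_le_left a b := by split_ifs <;> simp
  inf_le_right a b := by split_ifs with h <;> simp [h]
  le_inf a b c := by
    rintro (rfl | rfl) (h | h)
    · exact Or.inl rfl
    · exact Or.inl rfl
    · exact Or.inl h
    · subst h; simp

variable {T : Type w} [lang.Structure T] [Countable T]

/-- Each axiom concerns at most three points, and the substructure they generate is in the age. -/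
theorem IsGenericMeetTree.isMeetTree (hT : IsGenericMeetTree T) : IsMeetTree T := by
  have key : ∀ s : Set T, s.Finite → IsMeetTree (Substructure.closure lang s) := by
    intro s hs
    have h : (⟨Substructure.closure lang s, inferInstance⟩ : Bundled.{w} lang.Structure) ∈ lang.age T :=
      ⟨(Substructure.fg_iff_structure_fg _).1 (Substructure.fg_closure hs),
        ⟨(Substructure.closure lang s).subtype⟩⟩
    rw [hT.age] at h
    exact h.2
  have key' : ∀ a b c : T, ∃ S : lang.Substructure T, IsMeetTree S ∧ a ∈ S ∧ b ∈ S ∧ c ∈ S := by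
    intro a b c
    have hs := Substructure.subset_closure (L := lang) (s := ({a, b, c} : Set T))
    exact ⟨_, key {a, b, c} (Set.toFinite _), hs (by simp), hs (by simp), hs (by simp)⟩
  constructor
  · intro a
    obtain ⟨S, hS, ha, -, -⟩ := key' a a a
    exact (coe_le _ _).1 (hS.refl ⟨a, ha⟩)
  · intro a b h1 h2
    obtain ⟨S, hS, ha, hb, -⟩ := key' a b b
    exact congrArg Subtype.val (hS.antisymm ⟨a, ha⟩ ⟨b, hb⟩ ((coe_le _ _).2 h1) ((coe_le _ _).2 h2))
  · intro a b c h1 h2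
    obtain ⟨S, hS, ha, hb, hc⟩ := key' a b c
    exact (coe_le _ _).1 (hS.trans ⟨a, ha⟩ ⟨b, hb⟩ ⟨c, hc⟩ ((coe_le _ _).2 h1) ((coe_le _ _).2 h2))
  · intro a b c h1 h2
    obtain ⟨S, hS, ha, hb, hc⟩ := key' a b c
    exact (hS.semilinear ⟨a, ha⟩ ⟨b, hb⟩ ⟨c, hc⟩ ((coe_le _ _).2 h1) ((coe_le _ _).2 h2)).imp
      (coe_le _ _).1 (coe_le _ _).1
  · intro a b
    obtain ⟨S, hS, ha, hb, -⟩ := key' a b b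
    obtain ⟨c, h1, h2⟩ := hS.common_lower_bound ⟨a, ha⟩ ⟨b, hb⟩
    exact ⟨c, (coe_le _ _).1 h1, (coe_le _ _).1 h2⟩
  · intro a b
    obtain ⟨S, hS, ha, hb, -⟩ := key' a b b
    have := (coe_le _ _).1 (hS.meet_le_left ⟨a, ha⟩ ⟨b, hb⟩)
    rwa [coe_meet] at this
  · intro a b
    obtain ⟨S, hS, ha, hb, -⟩ := key' a b b
    have := (coe_le _ _).1 (hS.meet_le_right ⟨a, ha⟩ ⟨b, hb⟩)
    rwa [coe_meet] at this
  · intro a b c h1 h2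
    obtain ⟨S, hS, ha, hb, hc⟩ := key' a b c
    have := (coe_le _ _).1
      (hS.le_meet ⟨a, ha⟩ ⟨b, hb⟩ ⟨c, hc⟩ ((coe_le _ _).2 h1) ((coe_le _ _).2 h2))
    rwa [coe_meet] at this

theorem IsGenericMeetTree.exists_embedding (hT : IsGenericMeetTree T) {A : Type w}
    [SemilatticeInf A] [Finite A] (hA : Semilinear A) :
    ∃ φ : A → T, (∀ a b, le (φ a) (φ b) ↔ a ≤ b) ∧ ∀ a b, meet (φ a) (φ b) = φ (a ⊓ b) := by
  let := structureOfSemilatticeInf A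
  have h : (⟨A, inferInstance⟩ : Bundled.{w} lang.Structure) ∈ finiteMeetTrees.{w} :=
    ⟨‹Finite A›, isMeetTree_of_semilinear hA⟩
  rw [← hT.age] at h
  obtain ⟨φ⟩ := h.2
  exact ⟨φ, fun a b => map_le φ a b, fun a b => (map_meet φ a b).symm⟩

/-- Each extension property holds at one configuration, given by embedding a three-element chain or
a star, and homogeneity carries it everywhere. -/
theorem IsGenericMeetTree.isGenericOrder (hT : IsGenericMeetTree T) :
    letI := hT.isMeetTree.semilatticeInf
    IsGenericOrder T := by
  let := hT.isMeetTree.semilatticeInf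
  have hhom : ∀ s : Set (T × T), s.Finite →
      (∀ a ∈ s, ∀ b ∈ s, ∀ c ∈ s, a.1 ⊓ b.1 ≤ c.1 ↔ a.2 ⊓ b.2 ≤ c.2) →
      ∃ F : T ≃o T, ∀ a ∈ s, F a.1 = a.2 := by
    intro s hs h
    have := hs.to_subtype
    obtain ⟨θ, hθ⟩ := hT.isMeetTree.exists_equiv_closure (ι := s) (u := fun a => a.1.1)
      (v := fun a => a.1.2) (fun a b c => h a.1 a.2 b.1 b.2 c.1 c.2) rfl rfl
    obtain ⟨g, hg⟩ := hT.ultrahomogeneous _ (Substructure.fg_closure (Set.finite_range _))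
      ((Substructure.subtype _).comp θ.toEmbedding)
    refine ⟨⟨g.toEquiv, fun {a b} => map_le g a b⟩, fun a ha => ?_⟩
    have hm : a.1 ∈ Substructure.closure lang (Set.range fun a : s => a.1.1) :=
      Substructure.subset_closure ⟨⟨a, ha⟩, rfl⟩
    rw [← hθ ⟨a, ha⟩ hm]
    exact (DFunLike.congr_fun hg ⟨a.1, hm⟩).symm
  have hpoint : ∀ a b : T, ∃ F : T ≃o T, F a = b := by
    intro a b
    obtain ⟨F, hF⟩ := hhom {(a, b)} (Set.finite_singleton _) (by simp)
    exact ⟨F, hF _ rfl⟩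
  obtain ⟨φ, hφ, -⟩ := hT.exists_embedding (A := ULift (Fin 3)) (fun a b c _ _ => le_total a b)
  have hlt : ∀ a b, φ a < φ b ↔ a < b := fun a b => by
    rw [lt_iff_le_not_ge, lt_iff_le_not_ge]
    exact and_congr (hφ a b) (not_congr (hφ b a))
  refine ⟨hT.isMeetTree.semilinear, hhom, fun a b hab => ?_, fun a => ?_, fun S hS c => ?_⟩
  · have h02 : φ ⟨0⟩ < φ ⟨2⟩ := (hlt _ _).2 (by decide)
    obtain ⟨F, hF⟩ := hhom {(φ ⟨0⟩, a), (φ ⟨2⟩, b)} (Set.toFinite _) (by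
      rintro x (rfl | rfl) y (rfl | rfl) z (rfl | rfl) <;>
        simp [h02.le, hab.le, h02.not_ge, hab.not_ge])
    have ha : F (φ ⟨0⟩) = a := hF _ (Or.inl rfl)
    have hb : F (φ ⟨2⟩) = b := hF _ (Or.inr rfl)
    refine ⟨F (φ ⟨1⟩), ?_, ?_⟩
    · rw [← ha]; exact F.strictMono ((hlt _ _).2 (by decide))
    · rw [← hb]; exact F.strictMono ((hlt _ _).2 (by decide))
  · obtain ⟨F, hF⟩ := hpoint (φ ⟨1⟩) a
    exact ⟨F (φ ⟨0⟩), by rw [← hF]; exact F.strictMono ((hlt _ _).2 (by decide))⟩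
  · classical
    have := hS.to_subtype
    -- The star has |S| + 1 leaves, one more than S can block: an s meeting two leaves above c would
    -- give comparable elements below both, against their meet being c.
    let := starSemilatticeInf (Option S)
    obtain ⟨ψ, hψ, hψm⟩ := hT.exists_embedding (A := Option (Option S)) (by
      rintro a b c (rfl | rfl) (h | h)
      exacts [Or.inl (Or.inl rfl), Or.inl (Or.inl rfl), Or.inr (Or.inl h), Or.inr (Or.inr h)])
    obtain ⟨F, hF⟩ := hpoint (ψ none) c
    have hc : ∀ i, c < F (ψ (some i)) := fun i => by
      rw [← hF]
      apply F.strictMono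
      rw [lt_iff_le_not_ge]
      exact ⟨(hψ _ _).2 (Or.inl rfl), fun h => by rcases (hψ _ _).1 h with h | h <;> cases h⟩
    by_contra! hall
    choose s hs hsc using fun i => hall (F (ψ (some i))) (hc i)
    have hinj : Function.Injective fun i => (⟨s i, hs i⟩ : S) := by
      intro i j hij
      have hij : s i = s j := congrArg Subtype.val hij
      by_contra hne
      have hm : F (ψ (some i)) ⊓ F (ψ (some j)) = c := by
        rw [← map_inf, ← hF]
        congr 1
        refine (hψm _ _).trans ?_
        congr 1
        exact if_neg fun h => hne (Option.some.inj h)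
      have hsemi : Semilinear T := hT.isMeetTree.semilinear
      rcases hsemi (F (ψ (some i)) ⊓ s i) (F (ψ (some j)) ⊓ s j) (s i)
        inf_le_right (by rw [hij]; exact inf_le_right) with h | h
      · exact hsc i ((le_inf inf_le_left (h.trans inf_le_left)).trans hm.le)
      · exact hsc j ((le_inf (h.trans inf_le_left) inf_le_left).trans hm.le)
    have h1 := Nat.card_le_card_of_injective _ hinj
    rw [Finite.card_option] at h1
    exact absurd h1 (Nat.not_succ_le_self _)

end Fraisse

end MeetTree

namespace MeetTree

open PartialAut

/-! ### From PEC to its order-theoretic form -/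

section Translation

universe w

variable {T : Type w} [lang.Structure T]

/-- Within a meet-tree, an order automorphism preserves quantifier-free types. -/
theorem isPartialAut_lift (hA : IsMeetTree T) (F : T ≃ T) (hF : ∀ a b, le (F a) (F b) ↔ le a b) :
    IsPartialAut lang (PFun.lift F) := by
  intro n x y hxy φ _
  have hy : y = hA.equivOfOrder hA F hF ∘ x := by
    ext i
    exact Part.mem_some_iff.1 (hxy i)
  rw [hy]
  exact (StrongHomClass.realize_formula (hA.equivOfOrder hA F hF) φ).symm

theorem pow_lift {A : Type*} [SemilatticeInf A] (F : A ≃o A) (n : ℕ) (a : A) :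
    pow (PFun.lift F) n a = Part.some ((F ^ n) a) := by
  induction n with
  | zero => rfl
  | succ n ih =>
    rw [pow, PFun.comp_apply, ih]
    exact (Part.bind_some _ _).trans (congrArg Part.some (aut_pow_succ_apply F n a).symm)

theorem mem_pow_iff {A : Type*} [SemilatticeInf A] {p : A →. A} {f : A ≃o A}
    (hf : ∀ a b, b ∈ p a ↔ a ∈ p.Dom ∧ f a = b) (n : ℕ) (a b : A) :
    b ∈ pow p n a ↔ (∀ i < n, (f ^ i) a ∈ p.Dom) ∧ (f ^ n) a = b := by
  induction n generalizing b with
  | zero =>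
    change b ∈ Part.some a ↔ _
    rw [Part.mem_some_iff]
    exact ⟨fun h => ⟨fun i hi => absurd hi (Nat.not_lt_zero i), h.symm⟩, fun h => h.2.symm⟩
  | succ n ih =>
    rw [pow, PFun.comp_apply, aut_pow_succ_apply]
    refine Part.mem_bind_iff.trans ?_
    constructor
    · rintro ⟨c, hc, hb⟩
      obtain ⟨h1, rfl⟩ := (ih c).1 hc
      obtain ⟨h2, h3⟩ := (hf _ _).1 hb
      refine ⟨fun i hi => ?_, h3⟩
      rcases Nat.lt_succ_iff_lt_or_eq.1 hi with h | rfl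
      exacts [h1 i h, h2]
    · rintro ⟨h1, h2⟩
      exact ⟨_, (ih _).2 ⟨fun i hi => h1 i (by omega), rfl⟩, (hf _ _).2 ⟨h1 n (by omega), h2⟩⟩

/-- It is enough to take q total, both moving points equal to ζ and both exponents equal to m, and
to retain only the comparisons with η. The witnesses differ because `pow p m ζ` is undefined. -/
theorem IsPEC.orderPEC (hA : IsMeetTree T) {p : T →. T} (hp : IsPEC p) :
    letI := hA.semilatticeInf
    ∀ f : T ≃o T, (∀ a b, b ∈ p a ↔ a ∈ p.Dom ∧ f a = b) → OrderPEC p.Dom f := by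
  let := hA.semilatticeInf
  intro f hf F hF η hη ζ hζ m hm
  have hinit : ∀ a ∈ p.Dom \ f '' p.Dom, IsInitialPoint p a := by
    rintro a ⟨ha, ha'⟩
    refine ⟨ha, Or.inl ?_⟩
    rintro ⟨b, hb⟩
    obtain ⟨h1, h2⟩ := (hf _ _).1 hb
    exact ha' ⟨b, h1, h2⟩
  have hF' : ∀ a b, b ∈ p a ↔ a ∈ p.Dom ∧ F a = b := fun a b =>
    (hf a b).trans (and_congr_right fun ha => by rw [hF ha])
  have hm0 : 0 < m := Nat.pos_of_ne_zero fun h0 => hm fun i hi => by omega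
  have hmeet : ∀ k, MeetsDiffer (PFun.lift F) ζ k ↔ Splits F ζ k := by
    intro k
    simp only [MeetsDiffer, pow_lift, Part.mem_some_iff]
    constructor
    · rintro ⟨_, rfl, _, rfl, h⟩
      exact h
    · exact fun h => ⟨_, rfl, _, rfl, h⟩
  obtain ⟨m₁', m₂', m₁'', m₂'', h1, -, h2, -, hne, ⟨b', hb', c', -, b'', hb'', c'', -, h3, h4⟩, h5⟩ :=
    hp (PFun.lift F) (isPartialAut_lift hA F.toEquiv fun a b => F.le_iff_le)
      (fun a b hb => by rw [← ((hF' _ _).1 hb).2]; exact Part.mem_some _) η ζ ζ (hinit η hη)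
      (hinit ζ hζ) (hinit ζ hζ) m m hm0 hm0 ((F ^ m) ζ) ((F ^ m) ζ)
      (by rw [pow_lift]; exact Part.mem_some _) (by rw [pow_lift]; exact Part.mem_some _)
  have hdom : ¬ (pow p m ζ).Dom := by
    intro h
    exact hm ((mem_pow_iff hF' _ _ _).1 (Part.get_mem h)).1
  have hwit : ∀ m' b' c', b' ∈ pow p m' ζ →
      SameQFType lang ![η, (F ^ m) ζ, (F ^ m) ζ] ![η, b', c'] →
      (∀ k, IsLeast {k | MeetsDiffer (PFun.lift F) ζ k} k → m ≡ m' [MOD k]) →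
      Witness p.Dom F η ζ m m' := by
    intro m' b' c' hb' hs hk
    obtain ⟨g1, rfl⟩ := (mem_pow_iff hF' _ _ _).1 hb'
    refine ⟨g1, (SameQFType.le_iff hA hs 0 1).symm, (SameQFType.le_iff hA hs 1 0).symm,
      fun k hk' => hk k ?_⟩
    simpa only [hmeet] using hk'
  have w1 := hwit m₁' b' c' hb' h3 fun k hk => (h5 k hk).1
  have w2 := hwit m₁'' b'' c'' hb'' h4 fun k hk => (h5 k hk).2
  rcases lt_or_gt_of_ne (hne hdom) with h | h
  · exact ⟨m₁', m₁'', h1, h, w1, w2⟩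
  · exact ⟨m₁'', m₁', h2, h, w2, w1⟩

end Translation

/-! ### Strict extensions: existence and uniqueness -/

section StrictExtensions

universe w

variable {T : Type w} [lang.Structure T] {p : T →. T}

theorem mem_carrier (f : StrictExtension lang p) {a : T} (ha : a ∈ p.Dom) : a ∈ f.carrier := by
  obtain ⟨b, hb⟩ := (PFun.mem_dom p a).1 ha
  exact (f.extends_p a b hb).1

/-- The points of the orbits of `p.Dom` in a strict extension. -/
def orbitPoint (f : StrictExtension lang p) (x : p.Dom × ℤ) : T :=
  ((f.aut.toEquiv : Equiv.Perm f.carrier) ^ x.2) ⟨x.1, mem_carrier f x.1.2⟩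

theorem orbitPoint_mem (f : StrictExtension lang p) (x : p.Dom × ℤ) : orbitPoint f x ∈ f.carrier :=
  (((f.aut.toEquiv : Equiv.Perm f.carrier) ^ x.2) ⟨x.1, mem_carrier f x.1.2⟩).2

theorem closure_range_orbitPoint (f : StrictExtension lang p) :
    Substructure.closure lang (Set.range (orbitPoint f)) = f.carrier := by
  rw [← f.generated]
  congr 1
  ext b
  constructor
  · rintro ⟨⟨a, n⟩, rfl⟩
    exact ⟨⟨a, mem_carrier f a.2⟩, a.2, n, rfl⟩
  · rintro ⟨a, ha, n, rfl⟩
    exact ⟨(⟨a, ha⟩, n), rfl⟩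

theorem orbitPoint_add_one (f : StrictExtension lang p) (a : p.Dom) (n : ℤ) :
    orbitPoint f (a, n + 1) = f.aut ⟨orbitPoint f (a, n), orbitPoint_mem f (a, n)⟩ := by
  rw [orbitPoint, add_comm, zpow_add, zpow_one]
  rfl

/-- A shift by one lets homogeneity extend the orbit map to `T`; a large shift removes negative
exponents. -/
theorem orbitPoint_shift (f : StrictExtension lang p) (N : ℕ) (x y z : p.Dom × ℤ) :
    le (meet (orbitPoint f (x.1, x.2 + N)) (orbitPoint f (y.1, y.2 + N)))
      (orbitPoint f (z.1, z.2 + N)) ↔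
    le (meet (orbitPoint f x) (orbitPoint f y)) (orbitPoint f z) := by
  induction N with
  | zero => simp
  | succ N ih =>
    rw [← ih]
    push_cast
    rw [← add_assoc, ← add_assoc, ← add_assoc, orbitPoint_add_one, orbitPoint_add_one,
      orbitPoint_add_one, ← coe_meet, ← coe_le, ← map_meet, map_le, coe_le, coe_meet]

/-- Finite segments of the orbits in a strict extension are orbits of an automorphism. -/
theorem exists_aut_of_strictExtension (hA : IsMeetTree T)
    (hT : letI := hA.semilatticeInf; IsGenericOrder T) (hfin : p.Dom.Finite)
    (f : StrictExtension lang p) (M : ℕ) :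
    letI := hA.semilatticeInf
    ∃ F : T ≃o T, (∀ a b, b ∈ p a ↔ a ∈ p.Dom ∧ F a = b) ∧
      ∀ a : p.Dom, ∀ i ≤ M, (F ^ i) a = orbitPoint f (a, i) := by
  let := hA.semilatticeInf
  have := hfin.to_subtype
  obtain ⟨F, hF⟩ := hT.homogeneous
    (Set.range fun x : p.Dom × Fin (M + 1) =>
      (orbitPoint f (x.1, (x.2 : ℕ)), orbitPoint f (x.1, (x.2 : ℕ) + 1)))
    (Set.finite_range _) (by
      rintro _ ⟨x, rfl⟩ _ ⟨y, rfl⟩ _ ⟨z, rfl⟩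
      exact (orbitPoint_shift f 1 _ _ _).symm)
  have hF' : ∀ a : p.Dom, ∀ i ≤ M, F (orbitPoint f (a, i)) = orbitPoint f (a, i + 1) :=
    fun a i hi => hF _ ⟨(a, ⟨i, by omega⟩), rfl⟩
  refine ⟨F, fun a b => ?_, fun a i => ?_⟩
  · have key : ∀ c, c ∈ p a → F a = c := by
      intro c hc
      have ha : a ∈ p.Dom := (PFun.mem_dom p a).2 ⟨c, hc⟩
      obtain ⟨h, h'⟩ := f.extends_p a c hc
      rw [← h']
      exact (hF' ⟨a, ha⟩ 0 (Nat.zero_le M)).trans (orbitPoint_add_one f ⟨a, ha⟩ 0)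
    constructor
    · exact fun hb => ⟨(PFun.mem_dom p a).2 ⟨b, hb⟩, key b hb⟩
    · rintro ⟨ha, rfl⟩
      obtain ⟨c, hc⟩ := (PFun.mem_dom p a).1 ha
      rwa [key c hc]
  · induction i with
    | zero => exact fun _ => rfl
    | succ i ih =>
      intro hi
      rw [aut_pow_succ_apply, ih (by omega), hF' a i (by omega)]
      push_cast
      rfl

/-- Strict extensions of a pseudo existentially closed map realize the same types. -/
theorem IsPEC.orbitPoint_iff (hA : IsMeetTree T)
    (hT : letI := hA.semilatticeInf; IsGenericOrder T) (hfin : p.Dom.Finite) (hp : IsPEC p)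
    (f g : StrictExtension lang p) (x y z : p.Dom × ℤ) :
    le (meet (orbitPoint f x) (orbitPoint f y)) (orbitPoint f z) ↔
      le (meet (orbitPoint g x) (orbitPoint g y)) (orbitPoint g z) := by
  let := hA.semilatticeInf
  obtain ⟨x, i⟩ := x
  obtain ⟨y, j⟩ := y
  obtain ⟨z, k⟩ := z
  let N : ℕ := i.natAbs + j.natAbs + k.natAbs
  rw [← orbitPoint_shift f N, ← orbitPoint_shift g N]
  obtain ⟨i', hi'⟩ : ∃ i' : ℕ, i + N = i' := Int.eq_ofNat_of_zero_le (by omega)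
  obtain ⟨j', hj'⟩ : ∃ j' : ℕ, j + N = j' := Int.eq_ofNat_of_zero_le (by omega)
  obtain ⟨k', hk'⟩ : ∃ k' : ℕ, k + N = k' := Int.eq_ofNat_of_zero_le (by omega)
  obtain ⟨F, hF, hF'⟩ := exists_aut_of_strictExtension hA hT hfin f (i' + j' + k')
  obtain ⟨G, hG, hG'⟩ := exists_aut_of_strictExtension hA hT hfin g (i' + j' + k')
  have hGF : Set.EqOn G F p.Dom := by
    intro a ha
    obtain ⟨b, hb⟩ := (PFun.mem_dom p a).1 ha
    rw [((hF a b).1 hb).2, ((hG a b).1 hb).2]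
  obtain ⟨h, -, hh⟩ := OrderPEC.exists_aut_orbits hT (i' + j' + k') hfin (hp.orderPEC hA F hF) hGF
  simp only [hi', hj', hk']
  rw [← hF' x i' (by omega), ← hF' y j' (by omega), ← hF' z k' (by omega),
    ← hG' x i' (by omega), ← hG' y j' (by omega), ← hG' z k' (by omega),
    ← hh x x.2 i' (by omega), ← hh y y.2 j' (by omega), ← hh z z.2 k' (by omega)]
  change h ((G ^ i') x) ⊓ h ((G ^ j') y) ≤ h ((G ^ k') z) ↔
    (G ^ i') (x : T) ⊓ (G ^ j') y ≤ (G ^ k') z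
  rw [← map_inf, h.le_iff_le]

theorem IsPEC.isoOver (hA : IsMeetTree T)
    (hT : letI := hA.semilatticeInf; IsGenericOrder T) (hfin : p.Dom.Finite) (hp : IsPEC p)
    (f g : StrictExtension lang p) : f.IsoOver g := by
  obtain ⟨θ, hθ⟩ := hA.exists_equiv_closure (hp.orbitPoint_iff hA hT hfin f g)
    (closure_range_orbitPoint f) (closure_range_orbitPoint g)
  refine ⟨θ, fun a ha => hθ (⟨a, ha⟩, 0) a.2, fun a => ?_⟩
  have hgen : ∀ x, θ (f.aut ⟨orbitPoint f x, orbitPoint_mem f x⟩) =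
      g.aut (θ ⟨orbitPoint f x, orbitPoint_mem f x⟩) := by
    rintro ⟨x, n⟩
    have e1 : f.aut ⟨orbitPoint f (x, n), orbitPoint_mem f (x, n)⟩ =
        ⟨orbitPoint f (x, n + 1), orbitPoint_mem f (x, n + 1)⟩ :=
      Subtype.ext (orbitPoint_add_one f x n).symm
    have e2 : θ ⟨orbitPoint f (x, n), orbitPoint_mem f (x, n)⟩ =
        ⟨orbitPoint g (x, n), orbitPoint_mem g (x, n)⟩ :=
      Subtype.ext (hθ (x, n) _)
    rw [e1, e2]
    exact Subtype.ext ((hθ (x, n + 1) _).trans (orbitPoint_add_one g x n))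
  have ha : (a : T) ∈ Substructure.closure lang (Set.range (orbitPoint f)) := by
    rw [closure_range_orbitPoint]
    exact a.2
  obtain ⟨x, y, hxy⟩ := hA.exists_eq_meet ha
  have e : a = meet (⟨orbitPoint f x, orbitPoint_mem f x⟩ : f.carrier)
      ⟨orbitPoint f y, orbitPoint_mem f y⟩ :=
    Subtype.ext (hxy.trans (coe_meet _ _).symm)
  rw [e, map_meet, map_meet, hgen, hgen, map_meet, map_meet]

/-- An automorphism of `T` extending `p` permutes the union G of the orbits of `p.Dom`, hence
restricts to the closure of G. -/
theorem exists_strictExtension (hA : IsMeetTree T)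
    (hT : letI := hA.semilatticeInf; IsGenericOrder T) (hfin : p.Dom.Finite)
    (hp : IsPartialAut lang p) : Nonempty (StrictExtension lang p) := by
  let := hA.semilatticeInf
  have := hfin.to_subtype
  obtain ⟨F, hF⟩ := hT.homogeneous (Set.range fun a : p.Dom => (a.1, p.fn a.1 a.2))
    (Set.finite_range _) (by
      rintro _ ⟨a, rfl⟩ _ ⟨b, rfl⟩ _ ⟨c, rfl⟩
      refine SameQFType.meet_le_iff (hp 3 ![a.1, b.1, c.1]
        ![p.fn a.1 a.2, p.fn b.1 b.2, p.fn c.1 c.2] ?_) 0 1 2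
      intro i
      fin_cases i <;> exact Part.get_mem _)
  let e : Equiv.Perm T := F.toEquiv
  let G : Set T := {b | ∃ a ∈ p.Dom, ∃ n : ℤ, b = (e ^ n) a}
  let Φ : T ≃[lang] T := hA.equivOfOrder hA e fun a b => F.le_iff_le
  have hΦ : Substructure.map Φ.toHom (Substructure.closure lang G) = Substructure.closure lang G := by
    rw [← Substructure.closure_image]
    congr 1
    ext b
    constructor
    · rintro ⟨_, ⟨a, ha, n, rfl⟩, rfl⟩
      refine ⟨a, ha, 1 + n, ?_⟩
      rw [zpow_add, zpow_one]
      rfl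
    · rintro ⟨a, ha, n, rfl⟩
      refine ⟨_, ⟨a, ha, -1 + n, rfl⟩, ?_⟩
      change e ((e ^ (-1 + n)) a) = _
      rw [← Equiv.Perm.mul_apply, ← zpow_one_add, add_neg_cancel_left]
  have hmem : ∀ x, e x ∈ Substructure.closure lang G ↔ x ∈ Substructure.closure lang G := by
    intro x
    constructor
    · intro hx
      rw [← hΦ] at hx
      obtain ⟨y, hy, hyx⟩ := hx
      rwa [← e.injective hyx]
    · intro hx
      rw [← hΦ]
      exact ⟨x, hx, rfl⟩
  have hdom : ∀ a ∈ p.Dom, a ∈ Substructure.closure lang G := fun a ha =>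
    Substructure.subset_closure ⟨a, ha, 0, rfl⟩
  have hS := hA.substructure (Substructure.closure lang G)
  have hzpow : ∀ (n : ℤ) (a : Substructure.closure lang G),
      ((e.subtypePerm hmem ^ n) a : T) = (e ^ n) a := by
    intro n a
    rw [Equiv.Perm.subtypePerm_zpow]
    rfl
  refine ⟨⟨Substructure.closure lang G, hS.equivOfOrder hS (e.subtypePerm hmem) fun a b => ?_,
    fun a b hb => ?_, ?_⟩⟩
  · rw [coe_le, coe_le]
    exact F.le_iff_le
  · have ha : a ∈ p.Dom := (PFun.mem_dom p a).2 ⟨b, hb⟩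
    refine ⟨hdom a ha, ?_⟩
    exact (hF _ ⟨⟨a, ha⟩, rfl⟩).trans (Part.get_eq_of_mem hb _)
  · congr 1
    ext b
    constructor
    · rintro ⟨a, ha, n, rfl⟩
      exact ⟨a, ha, n, hzpow n a⟩
    · rintro ⟨a, ha, n, rfl⟩
      exact ⟨⟨a, hdom a ha⟩, ha, n, (hzpow n ⟨a, hdom a ha⟩).symm⟩

end StrictExtensions

end MeetTree

theorem mainTheorem4 {T : Type*} [MeetTree.lang.Structure T] [Countable T]
    (hT : MeetTree.IsGenericMeetTree T) (p : T →. T) (hfin : p.Dom.Finite)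
    (hp : PartialAut.IsPartialAut MeetTree.lang p) (hPEC : MeetTree.IsPEC p) :
    PartialAut.IsDetermined MeetTree.lang p := by
  obtain ⟨f⟩ := MeetTree.exists_strictExtension hT.isMeetTree hT.isGenericOrder hfin hp
  exact ⟨f, fun g => hPEC.isoOver hT.isMeetTree hT.isGenericOrder hfin f g⟩
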